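/- Let $d\ge 0$ be an integer, let $S^d=\{x\in\mathbb{R}^{d+1}:\|x\|=1\}$ with surface measure $d\omega$, and let $\kappa,\tau\in\mathbb{R}^{d+1}$ with $\kappa_j\ge 0$ and $\tau_j>-\tfrac12$ for all $1\le j\le d+1$. Put $h_\tau(x)=\prod_{j=1}^{d+1}|x_j|^{\tau_j}$, $\operatorname{meas}_\tau E=\int_E h_\tau^2\,d\omega$, and let $\|f\|_{\tau,p}$ be the norm of $L^p(h_\tau^2;S^d)=L^p(S^d,h_\tau^2\,d\omega)$; define $h_\kappa$ in the same way. Let $$V_\kappa g(x)=c_\kappa\int_{[-1,1]^{d+1}}g(x_1t_1,\dots,x_{d+1}t_{d+1})\prod_{i=1}^{d+1}(1+t_i)(1-t_i^2)^{\kappa_i-1}\,dt ,$$ where $c_\kappa$ is determined by $V_\kappa 1=1$; if $\kappa_i=0$, the normalized measure in the variable $t_i$ is replaced by its limit as $\kappa_i\to0^+$, the unit mass at $t_i=1$. For $x\in S^d$ let $B(x,\theta)=\{y\in\mathbb{R}^{d+1}:\|y\|\le1,\ \langle x,y\rangle\ge\cos\theta\}$ and $$\mathcal{M}_\kappa f(x)=\sup_{0<\theta\le\pi}\frac{\int_{S^d}|f(y)|\,V_\kappa[\chi_{B(x,\theta)}](y)\,h_\kappa^2(y)\,d\omega(y)}{\int_{S^d}V_\kappa[\chi_{B(x,\theta)}](y)\,h_\kappa^2(y)\,d\omega(y)}\in[0,\infty].$$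 (i) If $\tau_j\le\kappa_j$ for all $j$, there is a constant $c$, depending only on $d,\kappa,\tau$, such that for all $f\in L^1(h_\tau^2;S^d)$ and all $\alpha>0$, $$\operatorname{meas}_\tau\{x\in S^d:\mathcal{M}_\kappa f(x)\ge\alpha\}\le c\,\frac{\|f\|_{\tau,1}}{\alpha}.$$ (ii) If $1<p\le\infty$ and $\tau_j<p\kappa_j+\frac{p-1}{2}$ for all $j$ (no condition if $p=\infty$), there is a constant $c$, depending only on $d,\kappa,\tau,p$, such that for all $f\in L^p(h_\tau^2;S^d)$ the function $\mathcal{M}_\kappa f$ is measurable with respect to the completion of $h_\tau^2\,d\omega$ and $$\|\mathcal{M}_\kappa f\|_{\tau,p}\le c\,\|f\|_{\tau,p}.$$ (iii) For $p=\infty$ the estimate also holds on $C(S^d)$ with the uniform norm: there is a constant $c$, depending only on $d,\kappa,\tau$, with $\sup_{x\in S^d}\mathcal{M}_\kappa f(x)\le c\,\sup_{x\in S^d}|f(x)|$ for every continuous $f$ on $S^d$. -/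

import Mathlib

open MeasureTheory
open scoped ENNReal NNReal

noncomputable section

namespace SphereMaximal

/-- The Euclidean space `ℝ^{d+1}`. -/
abbrev E (d : ℕ) : Type := EuclideanSpace ℝ (Fin (d + 1))

/-- The unit sphere `S^d` of `ℝ^{d+1}`. -/
abbrev S (d : ℕ) : Type := Metric.sphere (0 : E d) 1

/-- The surface (Lebesgue) measure `dω` on `S^d`. -/
def surface (d : ℕ) : Measure (S d) := (volume : Measure (E d)).toSphere

/-- The product weight `h_τ(x) = ∏ⱼ |xⱼ|^{τⱼ}`. -/
def weight {d : ℕ} (τ : Fin (d + 1) → ℝ) (x : E d) : ℝ := ∏ j, |x j| ^ τ j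

/-- The measure `h_τ² dω` on `S^d`; its value on a set `A` is `meas_τ A`. -/
def weightedMeasure {d : ℕ} (τ : Fin (d + 1) → ℝ) : Measure (S d) :=
  (surface d).withDensity fun x => ENNReal.ofReal (weight τ (x : E d) ^ 2)

/-- The measure `(1 + t) (1 - t²)^{k-1} dt` on `[-1,1]`, before normalization. -/
def rawMeasure (k : ℝ) : Measure ℝ :=
  (volume.restrict (Set.Icc (-1 : ℝ) 1)).withDensity
    fun t => ENNReal.ofReal ((1 + t) * (1 - t ^ 2) ^ (k - 1))

/-- One factor of the measure that represents the intertwining operator of `ℤ₂^{d+1}`: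
for `k > 0` the probability measure proportional to `(1 + t) (1 - t²)^{k-1} dt` on `[-1,1]`;
for `k = 0` its weak limit as `k → 0+`, the unit mass at `1`. -/
def factorMeasure (k : ℝ) : Measure ℝ :=
  if k = 0 then Measure.dirac 1 else (rawMeasure k Set.univ)⁻¹ • rawMeasure k

/-- The intertwining operator `V_κ` of the group `ℤ₂^{d+1}`,
`V_κ g(x) = c_κ ∫_{[-1,1]^{d+1}} g(x₁t₁, …, x_{d+1}t_{d+1}) ∏ᵢ (1 + tᵢ) (1 - tᵢ²)^{κᵢ-1} dt`. -/
def V {d : ℕ} (κ : Fin (d + 1) → ℝ) (g : E d → ℝ) (x : E d) : ℝ :=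
  ∫ t, g (WithLp.toLp 2 fun i => x i * t i) ∂(Measure.pi fun i => factorMeasure (κ i))

/-- The solid cap `B(x,θ) = {y : ‖y‖ ≤ 1, ⟨x,y⟩ ≥ cos θ}`. -/
def solidCap {d : ℕ} (x : E d) (θ : ℝ) : Set (E d) :=
  {y | ‖y‖ ≤ 1 ∧ Real.cos θ ≤ inner ℝ x y}

/-- `V_κ[χ_{B(x,θ)}](y)`. -/
def kernel {d : ℕ} (κ : Fin (d + 1) → ℝ) (x : E d) (θ : ℝ) (y : E d) : ℝ :=
  V κ ((solidCap x θ).indicator fun _ => 1) y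

/-- The maximal function `𝓜_κ f`, with values in `[0,∞]`: the supremum over `0 < θ ≤ π` of
`∫ |f| V_κ[χ_{B(x,θ)}] h_κ² dω / ∫ V_κ[χ_{B(x,θ)}] h_κ² dω`. -/
def maximal {d : ℕ} (κ : Fin (d + 1) → ℝ) (f : S d → ℝ) (x : S d) : ℝ≥0∞ :=
  ⨆ θ ∈ Set.Ioc (0 : ℝ) Real.pi,
    (∫⁻ y, ‖f y‖ₑ * ENNReal.ofReal (kernel κ (x : E d) θ (y : E d)) ∂(weightedMeasure κ)) /
      (∫⁻ y, ENNReal.ofReal (kernel κ (x : E d) θ (y : E d)) ∂(weightedMeasure κ))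

end SphereMaximal

end

/-! The points y with | |x_j| - |y_j| | ≤ θ for all j form a ball `absBall x θ`, whose mass under
h_τ² dω is at most a constant times θ^d ∏ (|x_j|+θ)^{2τ_j} (`ballSize`) as soon as τ_j > -1/2. The
function V_κ[χ_{B(x,θ)}] vanishes off this ball and is at most a constant times ∏
(θ/(|x_j|+θ))^{2κ_j} on it (`exists_kernel_le`). A lower bound of the same order holds on a fixed
proportion of the ball (`exists_le_kernel`, `exists_le_surface_innerCap`). This decay factor cancels
between numerator and denominator, so the maximal function is dominated by the centred
Hardy–Littlewood function `ballMaximal κ` (`exists_maximal_le_ballMaximal`).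

It remains to pass from the weight κ to the weight τ. If τ ≤ κ, then h_κ²/h_τ² is bounded on each
ball by the ratio of the two ball sizes, so `ballMaximal κ` is at most `ballMaximal τ`, and Vitali's
covering lemma gives the weak type. For p > 1, choose q with 1 < q < p still satisfying the strict
condition on τ. Hölder's inequality bounds `ballMaximal κ g` by a constant times `ballMaximal τ
(g^q)` to the power 1/q (`exists_ballMaximal_le_rpow`), and the strong type at exponent p/q > 1
follows from the truncated weak type by the layer-cake formula. The case p = ∞ only uses that
averages do not exceed the supremum. -/

noncomputable section

namespace SphereMaximal

/-! ### One-dimensional power integrals. -/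

section OneDim

/-- Each sign of the exponent uses one of the two comparisons; assuming both spares case
distinctions on the exponents 2τ_j, which may be negative. -/
theorem rpow_le_mul_rpow_of_comparable {a b K : ℝ} (e : ℝ) (ha : 0 < a) (hb : 0 < b) (hK : 0 < K)
    (hab : a ≤ K * b) (hba : b ≤ K * a) : b ^ e ≤ K ^ |e| * a ^ e := by
  rcases le_total 0 e with he | he
  · rw [abs_of_nonneg he, ← Real.mul_rpow hK.le ha.le]
    exact Real.rpow_le_rpow hb.le hba he
  · rw [abs_of_nonpos he, Real.rpow_neg hK.le, ← Real.inv_rpow hK.le,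
      ← Real.mul_rpow (by positivity) ha.le]
    refine Real.rpow_le_rpow_of_nonpos (by positivity) ?_ he
    rw [inv_mul_le_iff₀ hK]
    exact hab

theorem lintegral_rpow_Ioc {a b : ℝ} (ha : -1 < a) (hb : 0 ≤ b) :
    ∫⁻ s in Set.Ioc 0 b, ENNReal.ofReal (s ^ a) = ENNReal.ofReal (b ^ (a + 1) / (a + 1)) := by
  have h1 : IntegrableOn (fun s : ℝ => s ^ a) (Set.Ioc 0 b) :=
    (intervalIntegrable_iff_integrableOn_Ioc_of_le hb).1
      (intervalIntegral.intervalIntegrable_rpow' ha)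
  rw [← ofReal_integral_eq_lintegral_ofReal h1, ← intervalIntegral.integral_of_le hb,
    integral_rpow (Or.inl ha), Real.zero_rpow (by linarith), sub_zero]
  filter_upwards [ae_restrict_mem measurableSet_Ioc] with s hs
  exact Real.rpow_nonneg hs.1.le _

theorem lintegral_one_sub_rpow_Ico {k δ : ℝ} (hk : 0 < k) (hδ : 0 ≤ δ) :
    ∫⁻ t in Set.Ico (1 - δ) 1, ENNReal.ofReal ((1 - t) ^ (k - 1)) = ENNReal.ofReal (δ ^ k / k) := by
  have h := lintegral_rpow_Ioc (a := k - 1) (by linarith) hδ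
  rw [sub_add_cancel] at h
  rw [← h, ← ((volume : Measure ℝ).measurePreserving_sub_left 1).setLIntegral_comp_preimage_emb
    (MeasurableEquiv.subLeft (1 : ℝ)).measurableEmbedding
    (fun s => ENNReal.ofReal (s ^ (k - 1))) (Set.Ioc 0 δ)]
  simp

theorem lintegral_abs_rpow_Icc_le {e b : ℝ} (he : -1 < e) (hb : 0 ≤ b) :
    ∫⁻ s in Set.Icc (-b) b, ENNReal.ofReal (|s| ^ e) ≤
      ENNReal.ofReal (2 * (b ^ (e + 1) / (e + 1))) := by
  have hpos : ∫⁻ s in Set.Icc 0 b, ENNReal.ofReal (|s| ^ e) =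
      ENNReal.ofReal (b ^ (e + 1) / (e + 1)) := by
    rw [← lintegral_rpow_Ioc he hb, Measure.restrict_congr_set Ioc_ae_eq_Icc.symm]
    refine setLIntegral_congr_fun measurableSet_Ioc fun s hs => ?_
    simp only [abs_of_pos hs.1]
  have hneg : ∫⁻ s in Set.Icc (-b) 0, ENNReal.ofReal (|s| ^ e) =
      ENNReal.ofReal (b ^ (e + 1) / (e + 1)) := by
    rw [← hpos, ← (Measure.measurePreserving_neg
      (volume : Measure ℝ)).setLIntegral_comp_preimage_emb
      (MeasurableEquiv.neg ℝ).measurableEmbedding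
      (fun s => ENNReal.ofReal (|s| ^ e)) (Set.Icc 0 b)]
    simp
  have hsub : Set.Icc (-b) b ⊆ Set.Icc (-b) 0 ∪ Set.Icc 0 b := by
    intro s hs
    rcases le_total s 0 with h | h
    · exact Or.inl ⟨hs.1, h⟩
    · exact Or.inr ⟨h, hs.2⟩
  have hnn : 0 ≤ b ^ (e + 1) / (e + 1) := div_nonneg (Real.rpow_nonneg hb _) (by linarith)
  calc _ ≤ _ := lintegral_mono_set hsub
    _ ≤ _ := lintegral_union_le _ _ _
    _ = _ := by rw [hpos, hneg, two_mul, ENNReal.ofReal_add hnn hnn]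

/-- Upper bound for the integral of a power over a neighbourhood of `{u, -u}`. -/
theorem exists_lintegral_abs_rpow_le {e : ℝ} (he : -1 < e) :
    ∃ C : ℝ, 0 < C ∧ ∀ u θ : ℝ, 0 ≤ u → 0 < θ →
      ∫⁻ s in {s : ℝ | |(|s| - u)| ≤ 4 * θ}, ENNReal.ofReal (|s| ^ e) ≤
        ENNReal.ofReal (C * (θ * (u + θ) ^ e)) := by
  have he1 : 0 < e + 1 := by linarith
  refine ⟨2 * 12 ^ (e + 1) / (e + 1) * 9 ^ |e| + 16 * 3 ^ |e|, by positivity, ?_⟩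
  intro u θ hu hθ
  have hX : 0 ≤ θ * (u + θ) ^ e := by positivity
  -- Near the origin the power may be singular and is integrated exactly, θ being comparable to u +
  -- θ. Away from it, |s| lies within a factor 3 of u + θ, so the integrand is essentially constant
  -- on two intervals of total length 16θ.
  rcases lt_or_ge u (8 * θ) with h | h
  · have hsub : {s : ℝ | |(|s| - u)| ≤ 4 * θ} ⊆ Set.Icc (-(12 * θ)) (12 * θ) := by
      intro s hs
      rw [Set.mem_ofPred_eq, abs_le] at hs
      rw [Set.mem_Icc, ← abs_le]
      linarith
    refine (lintegral_mono_set hsub).trans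
      ((lintegral_abs_rpow_Icc_le he (by positivity)).trans (ENNReal.ofReal_le_ofReal ?_))
    have h1 : θ ^ e ≤ 9 ^ |e| * (u + θ) ^ e :=
      rpow_le_mul_rpow_of_comparable e (by positivity) hθ (by norm_num) (by linarith) (by linarith)
    have h2 : (12 * θ) ^ (e + 1) = 12 ^ (e + 1) * (θ ^ e * θ) := by
      rw [Real.mul_rpow (by norm_num) hθ.le, Real.rpow_add_one hθ.ne']
    calc 2 * ((12 * θ) ^ (e + 1) / (e + 1))
        = 2 * 12 ^ (e + 1) / (e + 1) * θ * θ ^ e := by rw [h2]; ring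
      _ ≤ 2 * 12 ^ (e + 1) / (e + 1) * θ * (9 ^ |e| * (u + θ) ^ e) := by gcongr
      _ = 2 * 12 ^ (e + 1) / (e + 1) * 9 ^ |e| * (θ * (u + θ) ^ e) := by ring
      _ ≤ _ := by
        rw [add_mul]
        exact le_add_of_nonneg_right (by positivity)
  · have hsub : {s : ℝ | |(|s| - u)| ≤ 4 * θ} ⊆
        Set.Icc (u - 4 * θ) (u + 4 * θ) ∪ Set.Icc (-u - 4 * θ) (-u + 4 * θ) := by
      intro s hs
      rw [Set.mem_ofPred_eq, abs_le] at hs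
      rcases abs_cases s with ⟨h1, _⟩ | ⟨h1, _⟩ <;> rw [h1] at hs
      · exact Or.inl ⟨by linarith, by linarith⟩
      · exact Or.inr ⟨by linarith, by linarith⟩
    have hmeas : MeasurableSet {s : ℝ | |(|s| - u)| ≤ 4 * θ} :=
      measurableSet_le (by fun_prop) (by fun_prop)
    have hbound : ∀ s ∈ {s : ℝ | |(|s| - u)| ≤ 4 * θ},
        ENNReal.ofReal (|s| ^ e) ≤ ENNReal.ofReal (3 ^ |e| * (u + θ) ^ e) := by
      intro s hs
      rw [Set.mem_ofPred_eq, abs_le] at hs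
      refine ENNReal.ofReal_le_ofReal (rpow_le_mul_rpow_of_comparable e (by positivity)
        (by linarith) (by norm_num) ?_ ?_) <;> linarith
    have hvol : volume {s : ℝ | |(|s| - u)| ≤ 4 * θ} ≤ ENNReal.ofReal (16 * θ) := by
      refine (measure_mono hsub).trans ((measure_union_le _ _).trans ?_)
      rw [Real.volume_Icc, Real.volume_Icc, ← ENNReal.ofReal_add (by linarith) (by linarith)]
      exact ENNReal.ofReal_le_ofReal (by linarith)
    calc _ ≤ _ := setLIntegral_mono' hmeas hbound
      _ = ENNReal.ofReal (3 ^ |e| * (u + θ) ^ e) * volume {s : ℝ | |(|s| - u)| ≤ 4 * θ} := by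
        rw [setLIntegral_const]
      _ ≤ ENNReal.ofReal (3 ^ |e| * (u + θ) ^ e) * ENNReal.ofReal (16 * θ) := by gcongr
      _ = ENNReal.ofReal (16 * 3 ^ |e| * (θ * (u + θ) ^ e)) := by
        rw [← ENNReal.ofReal_mul (by positivity)]
        congr 1; ring
      _ ≤ _ := by
        refine ENNReal.ofReal_le_ofReal ?_
        rw [add_mul]
        exact le_add_of_nonneg_left (by positivity)

end OneDim

/-! ### Mass of the one-variable factors of V_κ near the endpoints ±1. -/

section Factor

/-- Separates the two endpoints: the density behaves like (1-t)^{k-1} at 1 and vanishes like (1+t)^k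
at -1. -/
theorem one_add_mul_one_sub_sq_rpow {k t : ℝ} (h1 : -1 < t) (h2 : t < 1) :
    (1 + t) * (1 - t ^ 2) ^ (k - 1) = (1 + t) ^ k * (1 - t) ^ (k - 1) := by
  have h3 : 0 < 1 + t := by linarith
  rw [show 1 - t ^ 2 = (1 + t) * (1 - t) by ring, Real.mul_rpow h3.le (by linarith),
    Real.rpow_sub_one h3.ne']
  field_simp

theorem rawMeasure_apply (k : ℝ) {A : Set ℝ} (hA : MeasurableSet A) :
    rawMeasure k A = ∫⁻ t in A ∩ Set.Ioo (-1 : ℝ) 1,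
      ENNReal.ofReal ((1 + t) ^ k * (1 - t) ^ (k - 1)) := by
  rw [rawMeasure, withDensity_apply _ hA, Measure.restrict_restrict hA]
  have : (A ∩ Set.Icc (-1 : ℝ) 1 : Set ℝ) =ᵐ[volume] (A ∩ Set.Ioo (-1 : ℝ) 1 : Set ℝ) :=
    Filter.EventuallyEq.rfl.inter Ioo_ae_eq_Icc.symm
  rw [Measure.restrict_congr_set this]
  refine setLIntegral_congr_fun (hA.inter measurableSet_Ioo) fun t ht => ?_
  simp only [one_add_mul_one_sub_sq_rpow ht.2.1 ht.2.2]

theorem le_rawMeasure_Ici {k δ : ℝ} (hk : 0 < k) (hδ : 0 ≤ δ) (hδ1 : δ ≤ 1) :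
    ENNReal.ofReal (δ ^ k / k) ≤ rawMeasure k (Set.Ici (1 - δ)) := by
  rw [rawMeasure_apply k measurableSet_Ici, ← lintegral_one_sub_rpow_Ico hk hδ]
  have hae : (Set.Ico (1 - δ) 1 : Set ℝ) ⊆ Set.Ici (1 - δ) ∩ Set.Ioo (-1 : ℝ) 1 :=
    fun t ht => ⟨ht.1, by linarith [ht.1], ht.2⟩
  refine le_trans ?_ (lintegral_mono_set hae)
  refine setLIntegral_mono' measurableSet_Ico fun t ht => ENNReal.ofReal_le_ofReal ?_
  have h1 : (1 : ℝ) ≤ (1 + t) ^ k := Real.one_le_rpow (by linarith [ht.1]) hk.le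
  exact le_mul_of_one_le_left (Real.rpow_nonneg (by linarith [ht.2]) _) h1

theorem rawMeasure_Ici_le {k δ : ℝ} (hk : 0 < k) (hδ : 0 ≤ δ) :
    rawMeasure k (Set.Ici (1 - δ)) ≤ ENNReal.ofReal (2 ^ k * (δ ^ k / k)) := by
  rw [rawMeasure_apply k measurableSet_Ici, ENNReal.ofReal_mul (by positivity),
    ← lintegral_one_sub_rpow_Ico hk hδ, ← lintegral_const_mul' _ _ ENNReal.ofReal_ne_top]
  have hae : Set.Ici (1 - δ) ∩ Set.Ioo (-1 : ℝ) 1 ⊆ (Set.Ico (1 - δ) 1 : Set ℝ) :=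
    fun t ht => ⟨ht.1, ht.2.2⟩
  refine le_trans ?_ (lintegral_mono_set hae)
  refine setLIntegral_mono' (measurableSet_Ici.inter measurableSet_Ioo) fun t ht => ?_
  rw [← ENNReal.ofReal_mul (by positivity)]
  refine ENNReal.ofReal_le_ofReal ?_
  have h1 : (1 + t) ^ k ≤ 2 ^ k :=
    Real.rpow_le_rpow (by linarith [ht.2.1]) (by linarith [ht.2.2]) hk.le
  exact mul_le_mul_of_nonneg_right h1 (Real.rpow_nonneg (by linarith [ht.2.2]) _)

/-- The vanishing of the density at -1, times a length at most 1, already gives the order δ^k found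
at the other endpoint; nothing sharper is needed. -/
theorem rawMeasure_Iic_le {k δ : ℝ} (hk : 0 < k) (hδ1 : δ ≤ 1) :
    rawMeasure k (Set.Iic (δ - 1)) ≤ ENNReal.ofReal (2 ^ k * δ ^ k) := by
  rw [rawMeasure_apply k measurableSet_Iic]
  have hb : ∀ t ∈ Set.Iic (δ - 1) ∩ Set.Ioo (-1 : ℝ) 1,
      ENNReal.ofReal ((1 + t) ^ k * (1 - t) ^ (k - 1)) ≤ ENNReal.ofReal (2 ^ k * δ ^ k) := by
    rintro t ⟨ht : t ≤ δ - 1, ht1, ht2⟩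
    refine ENNReal.ofReal_le_ofReal ?_
    have h1 : (1 + t) ^ k ≤ δ ^ k := Real.rpow_le_rpow (by linarith) (by linarith) hk.le
    have h2 : (1 - t) ^ (k - 1) ≤ 2 ^ k := by
      calc (1 - t) ^ (k - 1) ≤ (1 - t) ^ k :=
            Real.rpow_le_rpow_of_exponent_le (by linarith) (by linarith)
        _ ≤ 2 ^ k := Real.rpow_le_rpow (by linarith) (by linarith) hk.le
    rw [mul_comm]
    exact mul_le_mul h2 h1 (Real.rpow_nonneg (by linarith) _) (by positivity)
  have hvol : volume (Set.Iic (δ - 1) ∩ Set.Ioo (-1 : ℝ) 1) ≤ 1 := by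
    calc _ ≤ volume (Set.Icc (-1 : ℝ) 0) :=
          measure_mono fun t ht => ⟨ht.2.1.le, by linarith [show t ≤ δ - 1 from ht.1]⟩
      _ = 1 := by simp
  calc _ ≤ _ := setLIntegral_mono' (measurableSet_Iic.inter measurableSet_Ioo) hb
    _ = _ := setLIntegral_const _ _
    _ ≤ _ := mul_le_of_le_one_right' hvol

theorem rawMeasure_univ_ne_zero {k : ℝ} (hk : 0 < k) : rawMeasure k Set.univ ≠ 0 := by
  have h := (le_rawMeasure_Ici hk zero_le_one le_rfl).trans (measure_mono (Set.subset_univ _))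
  refine (lt_of_lt_of_le ?_ h).ne'
  rw [ENNReal.ofReal_pos]
  simpa using hk

theorem rawMeasure_univ_ne_top {k : ℝ} (hk : 0 < k) : rawMeasure k Set.univ ≠ ∞ := by
  have h := rawMeasure_Ici_le hk zero_le_two
  have h2 : rawMeasure k Set.univ = rawMeasure k (Set.Ici (1 - 2)) := by
    rw [rawMeasure_apply k MeasurableSet.univ, rawMeasure_apply k measurableSet_Ici]
    congr 2
    ext t
    simp only [Set.mem_inter_iff, Set.mem_univ, Set.mem_Ioo, Set.mem_Ici]
    constructor
    · rintro ⟨-, h⟩; exact ⟨by linarith, h⟩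
    · rintro ⟨-, h⟩; exact ⟨trivial, h⟩
  rw [h2]
  exact ne_top_of_le_ne_top ENNReal.ofReal_ne_top h

theorem isProbabilityMeasure_factorMeasure {k : ℝ} (hk : 0 ≤ k) :
    IsProbabilityMeasure (factorMeasure k) := by
  rw [factorMeasure]
  split_ifs with h
  · infer_instance
  · have hk' : 0 < k := lt_of_le_of_ne hk (Ne.symm h)
    refine ⟨?_⟩
    rw [Measure.smul_apply, smul_eq_mul]
    exact ENNReal.inv_mul_cancel (rawMeasure_univ_ne_zero hk') (rawMeasure_univ_ne_top hk')

theorem ae_factorMeasure_mem_Icc (k : ℝ) : ∀ᵐ t ∂(factorMeasure k), t ∈ Set.Icc (-1 : ℝ) 1 := by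
  rw [factorMeasure]
  split_ifs with h
  · exact (ae_dirac_iff measurableSet_Icc).2 (by norm_num)
  · refine Measure.ae_smul_measure ?_ _
    exact (withDensity_absolutelyContinuous _ _).ae_le (ae_restrict_mem measurableSet_Icc)

theorem exists_le_factorMeasure_Ici {k : ℝ} (hk : 0 ≤ k) :
    ∃ c : ℝ, 0 < c ∧ ∀ δ : ℝ, 0 ≤ δ → δ ≤ 1 →
      ENNReal.ofReal (c * δ ^ k) ≤ factorMeasure k (Set.Ici (1 - δ)) := by
  rcases hk.eq_or_lt with rfl | hk'
  · refine ⟨1, one_pos, fun δ hδ _ => ?_⟩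
    rw [factorMeasure, if_pos rfl, Measure.dirac_apply' _ measurableSet_Ici]
    simp [hδ]
  · have h0 := rawMeasure_univ_ne_zero hk'
    have h1 := rawMeasure_univ_ne_top hk'
    have hr : 0 < (rawMeasure k Set.univ).toReal := ENNReal.toReal_pos h0 h1
    refine ⟨((rawMeasure k Set.univ).toReal)⁻¹ / k, by positivity, fun δ hδ hδ1 => ?_⟩
    rw [factorMeasure, if_neg hk'.ne', Measure.smul_apply, smul_eq_mul]
    calc ENNReal.ofReal (((rawMeasure k Set.univ).toReal)⁻¹ / k * δ ^ k)
        = (rawMeasure k Set.univ)⁻¹ * ENNReal.ofReal (δ ^ k / k) := by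
          rw [show ((rawMeasure k Set.univ).toReal)⁻¹ / k * δ ^ k =
            ((rawMeasure k Set.univ).toReal)⁻¹ * (δ ^ k / k) by ring,
            ENNReal.ofReal_mul (by positivity), ENNReal.ofReal_inv_of_pos hr,
            ENNReal.ofReal_toReal h1]
      _ ≤ _ := by gcongr; exact le_rawMeasure_Ici hk' hδ hδ1

/-- Both endpoints matter because the sign of x_j y_j decides which one the cap selects. Having C ≥
1 lets the trivial bound by total mass 1 be absorbed. -/
theorem exists_factorMeasure_le {k : ℝ} (hk : 0 ≤ k) :
    ∃ C : ℝ, 1 ≤ C ∧ ∀ δ : ℝ, 0 < δ →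
      factorMeasure k (Set.Ici (1 - δ)) ≤ ENNReal.ofReal (C * δ ^ k) ∧
      factorMeasure k (Set.Iic (δ - 1)) ≤ ENNReal.ofReal (C * δ ^ k) := by
  have := isProbabilityMeasure_factorMeasure hk
  rcases hk.eq_or_lt with rfl | hk'
  · refine ⟨1, le_rfl, fun δ _ => ?_⟩
    simp [prob_le_one]
  · have h0 := rawMeasure_univ_ne_zero hk'
    have h1 := rawMeasure_univ_ne_top hk'
    have hr : 0 < (rawMeasure k Set.univ).toReal := ENNReal.toReal_pos h0 h1
    set R := (rawMeasure k Set.univ).toReal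
    have hR : ∀ (b : ℝ) (A : Set ℝ), 0 ≤ b → rawMeasure k A ≤ ENNReal.ofReal b →
        factorMeasure k A ≤ ENNReal.ofReal (R⁻¹ * b) := by
      intro b A hb hA
      rw [factorMeasure, if_neg hk'.ne', Measure.smul_apply, smul_eq_mul,
        ENNReal.ofReal_mul (by positivity), ENNReal.ofReal_inv_of_pos hr, ENNReal.ofReal_toReal h1]
      gcongr
    refine ⟨1 + R⁻¹ * (2 ^ k / k) + R⁻¹ * 2 ^ k, ?_, fun δ hδ => ?_⟩
    · have : 0 ≤ R⁻¹ * (2 ^ k / k) + R⁻¹ * 2 ^ k := by positivity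
      linarith
    rcases le_or_gt δ 1 with hδ1 | hδ1
    · have hd : 0 ≤ δ ^ k := by positivity
      constructor
      · refine (hR _ _ (by positivity) (rawMeasure_Ici_le hk' hδ.le)).trans
          (ENNReal.ofReal_le_ofReal ?_)
        have : 0 ≤ 1 * δ ^ k + R⁻¹ * 2 ^ k * δ ^ k := by positivity
        rw [show R⁻¹ * (2 ^ k * (δ ^ k / k)) = R⁻¹ * (2 ^ k / k) * δ ^ k by ring]
        linarith
      · refine (hR _ _ (by positivity) (rawMeasure_Iic_le hk' hδ1)).trans
          (ENNReal.ofReal_le_ofReal ?_)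
        have : 0 ≤ 1 * δ ^ k + R⁻¹ * (2 ^ k / k) * δ ^ k := by positivity
        rw [← mul_assoc]
        linarith
    · have h2 : (1 : ℝ≥0∞) ≤ ENNReal.ofReal ((1 + R⁻¹ * (2 ^ k / k) + R⁻¹ * 2 ^ k) * δ ^ k) := by
        rw [ENNReal.one_le_ofReal]
        have h3 : 1 ≤ δ ^ k := Real.one_le_rpow hδ1.le hk
        have h4 : 0 ≤ R⁻¹ * (2 ^ k / k) + R⁻¹ * 2 ^ k := by positivity
        calc (1 : ℝ) ≤ 1 * δ ^ k := by linarith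
          _ ≤ _ := by gcongr; linarith
      exact ⟨prob_le_one.trans h2, prob_le_one.trans h2⟩

end Factor

/-! ### Polar coordinates. -/

section Polar

/-- Trades the sphere for ℝ^{d+1}, where product integrands split coordinate by coordinate; sets on
the sphere are estimated by thickening them radially. -/
theorem lintegral_eq_lintegral_surface {d : ℕ} {F : E d → ℝ≥0∞} (hF : Measurable F) :
    ∫⁻ z, F z = ∫⁻ ω : S d, (∫⁻ r in Set.Ioi (0 : ℝ),
      ENNReal.ofReal (r ^ d) * F (r • (ω : E d))) ∂(surface d) := by
  have hdim : Module.finrank ℝ (E d) - 1 = d := by simp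
  have hmp := (volume : Measure (E d)).measurePreserving_homeomorphUnitSphereProd
  rw [hdim] at hmp
  have hG : Measurable fun p : S d × Set.Ioi (0 : ℝ) => F ((p.2 : ℝ) • (p.1 : E d)) := by
    fun_prop
  calc ∫⁻ z, F z = ∫⁻ z : ({(0 : E d)}ᶜ : Set (E d)), F z ∂(volume.comap Subtype.val) := by
        rw [lintegral_subtype_comap (measurableSet_singleton _).compl,
          MeasureTheory.restrict_compl_singleton]
    _ = ∫⁻ p, F ((p.2 : ℝ) • (p.1 : E d)) ∂((surface d).prod (Measure.volumeIoiPow d)) := by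
        rw [surface, ← hmp.lintegral_comp hG]
        refine lintegral_congr fun z => ?_
        congr 1
        have hz : ‖(z : E d)‖ ≠ 0 := norm_ne_zero_iff.2 z.2
        simp [smul_smul, hz]
    _ = ∫⁻ ω : S d, ∫⁻ r : Set.Ioi (0 : ℝ), F ((r : ℝ) • (ω : E d))
          ∂(Measure.volumeIoiPow d) ∂(surface d) := lintegral_prod _ hG.aemeasurable
    _ = _ := by
        refine lintegral_congr fun ω => ?_
        rw [Measure.volumeIoiPow, lintegral_withDensity_eq_lintegral_mul _ (by fun_prop)
          (by fun_prop)]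
        exact lintegral_subtype_comap measurableSet_Ioi
          (fun r : ℝ => ENNReal.ofReal (r ^ d) * F (r • (ω : E d)))

end Polar

/-! ### Product integrals, boxes and coordinate bounds. -/

section Volume

theorem lintegral_pi_prod_eq_prod {n : ℕ} {f : Fin n → ℝ → ℝ≥0∞} (hf : ∀ i, Measurable (f i)) :
    ∫⁻ x : Fin n → ℝ, ∏ i, f i (x i) = ∏ i, ∫⁻ s, f i s := by
  induction n with
  | zero => simp [volume_pi]
  | succ n ih =>
    rw [← (volume_preserving_piFinSuccAbove (fun _ : Fin (n + 1) => ℝ) 0).symm.lintegral_comp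
      (by fun_prop), Fin.prod_univ_succ, ← ih fun i => hf i.succ]
    simp only [MeasurableEquiv.piFinSuccAbove_symm_apply, Fin.insertNthEquiv,
      Fin.prod_univ_succ, Fin.insertNth_zero, Equiv.coe_fn_mk, Fin.cons_succ, Fin.cons_zero]
    have hm : Measurable fun x : Fin n → ℝ => ∏ i, f i.succ (x i) :=
      Finset.measurable_prod _ fun i _ => (hf i.succ).comp (measurable_pi_apply i)
    exact lintegral_prod_mul (hf 0).aemeasurable hm.aemeasurable

theorem lintegral_euclidean_prod_eq_prod {d : ℕ} {f : Fin (d + 1) → ℝ → ℝ≥0∞}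
    (hf : ∀ i, Measurable (f i)) :
    ∫⁻ z : E d, ∏ i, f i (z i) = ∏ i, ∫⁻ s, f i s := by
  rw [← lintegral_pi_prod_eq_prod hf,
    ← (PiLp.volume_preserving_toLp (Fin (d + 1))).lintegral_comp (by fun_prop)]

theorem volume_euclidean_box {d : ℕ} (l u : Fin (d + 1) → ℝ) :
    volume {z : E d | ∀ j, z j ∈ Set.Icc (l j) (u j)} = ∏ j, ENNReal.ofReal (u j - l j) := by
  rw [← Real.volume_Icc_pi, ← (PiLp.volume_preserving_toLp (Fin (d + 1))).measure_preimage
    (by measurability)]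
  congr 1
  ext z
  simp [Set.mem_Icc, Pi.le_def, forall_and]

theorem norm_le_mul_of_forall_abs_le {d : ℕ} {z : E d} {a : ℝ} (ha : 0 ≤ a)
    (h : ∀ j, |z j| ≤ a) : ‖z‖ ≤ (d + 1) * a := by
  rw [EuclideanSpace.norm_eq, Real.sqrt_le_left (by positivity)]
  have h1 : ∀ j, ‖z j‖ ^ 2 ≤ a ^ 2 := fun j => by
    rw [Real.norm_eq_abs]
    exact pow_le_pow_left₀ (abs_nonneg _) (h j) 2
  calc ∑ j, ‖z j‖ ^ 2 ≤ ∑ _j : Fin (d + 1), a ^ 2 := Finset.sum_le_sum fun j _ => h1 j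
    _ = (d + 1) * a ^ 2 := by simp
    _ ≤ ((d + 1) * a) ^ 2 := by
      have hd : (1 : ℝ) ≤ d + 1 := by
        have : (0 : ℝ) ≤ d := Nat.cast_nonneg d
        linarith
      rw [mul_pow]
      gcongr
      nlinarith

theorem sum_sq_eq_one {d : ℕ} (x : S d) : ∑ j, ((x : E d) j) ^ 2 = 1 := by
  have h : ‖(x : E d)‖ = 1 := by simp
  rw [← EuclideanSpace.real_norm_sq_eq, h, one_pow]

theorem norm_coe_eq_one {d : ℕ} (x : S d) : ‖(x : E d)‖ = 1 := by simp

theorem abs_coe_le_one {d : ℕ} (x : S d) (j : Fin (d + 1)) : |(x : E d) j| ≤ 1 := by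
  have := PiLp.norm_apply_le (x : E d) j
  rwa [norm_coe_eq_one, Real.norm_eq_abs] at this

end Volume

/-! ### Measure of balls and inner caps on the sphere. -/

section Balls

variable {d : ℕ}

/-- The points of the sphere whose coordinates agree with those of `x` in absolute value,
up to `θ`. -/
def absBall (x : E d) (θ : ℝ) : Set (S d) := {y | ∀ j, |(|x j| - |(y : E d) j|)| ≤ θ}

/-- The size of `absBall x θ` with respect to `h_τ² dω`, up to constants. -/
def ballSize (τ : Fin (d + 1) → ℝ) (x : E d) (θ : ℝ) : ℝ :=
  θ ^ d * ∏ j, (|x j| + θ) ^ (2 * τ j)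

theorem ballSize_pos (τ : Fin (d + 1) → ℝ) (x : E d) {θ : ℝ} (hθ : 0 < θ) :
    0 < ballSize τ x θ :=
  mul_pos (pow_pos hθ _) (Finset.prod_pos fun _ _ =>
    Real.rpow_pos_of_pos (add_pos_of_nonneg_of_pos (abs_nonneg _) hθ) _)

theorem measurableSet_absBall (x : E d) (θ : ℝ) : MeasurableSet (absBall x θ) := by
  have : absBall x θ = ⋂ j, {y : S d | |(|x j| - |(y : E d) j|)| ≤ θ} := by
    ext y; simp [absBall]
  rw [this]
  exact MeasurableSet.iInter fun j => measurableSet_le (by fun_prop) (by fun_prop)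

theorem absBall_mono (x : E d) {θ θ' : ℝ} (h : θ ≤ θ') : absBall x θ ⊆ absBall x θ' :=
  fun _ hy j => (hy j).trans h

theorem weight_sq (τ : Fin (d + 1) → ℝ) (x : E d) :
    weight τ x ^ 2 = ∏ j, |x j| ^ (2 * τ j) := by
  rw [weight, ← Finset.prod_pow]
  refine Finset.prod_congr rfl fun j _ => ?_
  rw [mul_comm, Real.rpow_mul (abs_nonneg _)]
  norm_cast

theorem measurable_weight (τ : Fin (d + 1) → ℝ) : Measurable (weight τ : E d → ℝ) := by
  unfold weight
  fun_prop

theorem measurable_weight_density (τ : Fin (d + 1) → ℝ) :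
    Measurable fun x : S d => ENNReal.ofReal (weight τ (x : E d) ^ 2) :=
  (((measurable_weight τ).comp measurable_subtype_coe).pow_const 2).ennreal_ofReal

instance : IsFiniteMeasure (surface d) := by
  unfold surface
  infer_instance

theorem rpow_abs_le_mul_rpow_abs_smul {r K s : ℝ} (e : ℝ) (hr : 1 ≤ r) (hrK : r ≤ K) :
    |s| ^ e ≤ K ^ |e| * |r * s| ^ e := by
  have hK : 1 ≤ K := hr.trans hrK
  rcases eq_or_ne s 0 with rfl | hs
  · rw [mul_zero]
    refine le_mul_of_one_le_left (Real.rpow_nonneg (abs_nonneg _) _) ?_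
    exact Real.one_le_rpow hK (abs_nonneg _)
  · have hs' : 0 < |s| := abs_pos.2 hs
    rw [abs_mul, abs_of_pos (by linarith : 0 < r)]
    refine rpow_le_mul_rpow_of_comparable e (by positivity) hs' (by linarith) ?_ ?_
    · gcongr
    · nlinarith [mul_le_mul hK hr zero_le_one (by linarith)]

/-- Upper bound for the weighted measure of a ball. -/
theorem exists_weightedMeasure_absBall_le {σ : Fin (d + 1) → ℝ} (hσ : ∀ j, -(1 / 2 : ℝ) < σ j) :
    ∃ C : ℝ, 0 < C ∧ ∀ (x : S d) (θ : ℝ), 0 < θ → θ ≤ Real.pi →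
      weightedMeasure σ (absBall (x : E d) (3 * θ)) ≤
        ENNReal.ofReal (C * ballSize σ (x : E d) θ) := by
  have hex := fun j => exists_lintegral_abs_rpow_le (e := 2 * σ j) (by linarith [hσ j])
  choose C hC0 hC using hex
  set K : ℝ := 1 + Real.pi with hK
  have hK0 : 0 < K := by positivity
  set K' : ℝ := ∏ j, K ^ |2 * σ j| with hK'
  have hK'0 : 0 < K' := Finset.prod_pos fun j _ => Real.rpow_pos_of_pos hK0 _
  have hCp : 0 < ∏ j, C j := Finset.prod_pos fun j _ => hC0 j
  refine ⟨K' * ∏ j, C j, by positivity, fun x θ hθ hθπ => ?_⟩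
  -- The ball of radius 3θ is thickened to the shell 1 ≤ r ≤ 1 + θ. As |ω_j| ≤ 1, each coordinate
  -- moves by at most θ, hence 4θ; dividing by the thickness θ at the end leaves the power θ^d.
  set A : Fin (d + 1) → Set ℝ := fun j => {s : ℝ | |(|s| - |(x : E d) j|)| ≤ 4 * θ} with hA
  have hAm : ∀ j, MeasurableSet (A j) := fun j => measurableSet_le (by fun_prop) (by fun_prop)
  set g : Fin (d + 1) → ℝ → ℝ≥0∞ := fun j =>
    (A j).indicator fun s => ENNReal.ofReal (|s| ^ (2 * σ j)) with hg
  have hgm : ∀ j, Measurable (g j) := fun j => Measurable.indicator (by fun_prop) (hAm j)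
  set F : E d → ℝ≥0∞ := fun z => ∏ j, g j (z j) with hF
  have hFm : Measurable F := by
    refine Finset.measurable_prod _ fun j _ => (hgm j).comp (by fun_prop)
  have hupper : ∫⁻ z, F z ≤
      ENNReal.ofReal ((∏ j, C j) * ballSize σ (x : E d) θ * θ) := by
    rw [hF, lintegral_euclidean_prod_eq_prod hgm]
    calc ∏ j, ∫⁻ s, g j s
        ≤ ∏ j, ENNReal.ofReal (C j * (θ * (|(x : E d) j| + θ) ^ (2 * σ j))) := by
          refine Finset.prod_le_prod' fun j _ => ?_
          rw [hg, lintegral_indicator (hAm j)]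
          exact hC j _ θ (abs_nonneg _) hθ
      _ = _ := by
          rw [← ENNReal.ofReal_prod_of_nonneg fun j _ => mul_nonneg (hC0 j).le (by positivity)]
          congr 1
          rw [Finset.prod_mul_distrib, Finset.prod_mul_distrib, ballSize]
          simp only [Finset.prod_const, Finset.card_univ, Fintype.card_fin]
          ring
  have hinner : ∀ ω ∈ absBall (x : E d) (3 * θ),
      ENNReal.ofReal θ * ENNReal.ofReal (weight σ (ω : E d) ^ 2) ≤
        ENNReal.ofReal K' * ∫⁻ r in Set.Ioi (0 : ℝ),
          ENNReal.ofReal (r ^ d) * F (r • (ω : E d)) := by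
    intro ω hω
    have hpt : ∀ r ∈ Set.Icc 1 (1 + θ), ENNReal.ofReal (weight σ (ω : E d) ^ 2) ≤
        ENNReal.ofReal K' * (ENNReal.ofReal (r ^ d) * F (r • (ω : E d))) := by
      intro r hr
      have hr0 : (0 : ℝ) < r := by linarith [hr.1]
      have h1 : ∀ j, g j ((r • (ω : E d)) j) = ENNReal.ofReal (|r * (ω : E d) j| ^ (2 * σ j)) := by
        intro j
        rw [hg, PiLp.smul_apply, smul_eq_mul]
        refine Set.indicator_of_mem ?_ _
        rw [hA, Set.mem_ofPred_eq, abs_mul, abs_of_pos hr0]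
        have h2 := abs_le.1 (hω j)
        have h3 := abs_coe_le_one ω j
        have h4 : (r - 1) * |(ω : E d) j| ≤ θ * 1 :=
          mul_le_mul (by linarith [hr.2]) h3 (abs_nonneg _) hθ.le
        have h5 : 0 ≤ (r - 1) * |(ω : E d) j| :=
          mul_nonneg (by linarith [hr.1]) (abs_nonneg _)
        rw [abs_le]
        constructor <;> linarith
      have h2 : ENNReal.ofReal (weight σ (ω : E d) ^ 2) ≤ ENNReal.ofReal K' * F (r • (ω : E d)) := by
        rw [hF]
        simp only [h1]
        rw [← ENNReal.ofReal_prod_of_nonneg fun j _ => by positivity,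
          ← ENNReal.ofReal_mul hK'0.le, weight_sq, hK', ← Finset.prod_mul_distrib]
        refine ENNReal.ofReal_le_ofReal (Finset.prod_le_prod (fun j _ => by positivity) fun j _ => ?_)
        exact rpow_abs_le_mul_rpow_abs_smul _ hr.1 (by linarith [hr.2])
      refine h2.trans ?_
      gcongr
      refine le_mul_of_one_le_left' ?_
      rw [ENNReal.one_le_ofReal]
      exact one_le_pow₀ hr.1
    calc ENNReal.ofReal θ * ENNReal.ofReal (weight σ (ω : E d) ^ 2)
        = ∫⁻ _ in Set.Icc 1 (1 + θ), ENNReal.ofReal (weight σ (ω : E d) ^ 2) := by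
          rw [setLIntegral_const, Real.volume_Icc, add_sub_cancel_left, mul_comm]
      _ ≤ ∫⁻ r in Set.Icc 1 (1 + θ),
            ENNReal.ofReal K' * (ENNReal.ofReal (r ^ d) * F (r • (ω : E d))) :=
          setLIntegral_mono' measurableSet_Icc hpt
      _ ≤ ∫⁻ r in Set.Ioi (0 : ℝ),
            ENNReal.ofReal K' * (ENNReal.ofReal (r ^ d) * F (r • (ω : E d))) :=
          lintegral_mono_set fun r hr => lt_of_lt_of_le one_pos hr.1
      _ = _ := lintegral_const_mul' _ _ ENNReal.ofReal_ne_top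
  have hmain : ENNReal.ofReal θ * weightedMeasure σ (absBall (x : E d) (3 * θ)) ≤
      ENNReal.ofReal θ * ENNReal.ofReal ((K' * ∏ j, C j) * ballSize σ (x : E d) θ) := by
    calc ENNReal.ofReal θ * weightedMeasure σ (absBall (x : E d) (3 * θ))
        = ∫⁻ ω in absBall (x : E d) (3 * θ),
            ENNReal.ofReal θ * ENNReal.ofReal (weight σ (ω : E d) ^ 2) ∂(surface d) := by
          rw [weightedMeasure, withDensity_apply _ (measurableSet_absBall _ _),
            lintegral_const_mul' _ _ ENNReal.ofReal_ne_top]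
      _ ≤ ∫⁻ ω in absBall (x : E d) (3 * θ), ENNReal.ofReal K' * (∫⁻ r in Set.Ioi (0 : ℝ),
            ENNReal.ofReal (r ^ d) * F (r • (ω : E d))) ∂(surface d) :=
          setLIntegral_mono' (measurableSet_absBall _ _) hinner
      _ ≤ ∫⁻ ω : S d, ENNReal.ofReal K' * (∫⁻ r in Set.Ioi (0 : ℝ),
            ENNReal.ofReal (r ^ d) * F (r • (ω : E d))) ∂(surface d) :=
          setLIntegral_le_lintegral _ _
      _ = ENNReal.ofReal K' * ∫⁻ z, F z := by
          rw [lintegral_const_mul' _ _ ENNReal.ofReal_ne_top, ← lintegral_eq_lintegral_surface hFm]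
      _ ≤ ENNReal.ofReal K' * ENNReal.ofReal ((∏ j, C j) * ballSize σ (x : E d) θ * θ) := by
          gcongr
      _ = _ := by
          rw [← ENNReal.ofReal_mul hK'0.le, ← ENNReal.ofReal_mul hθ.le]
          congr 1
          ring
  rwa [ENNReal.mul_le_mul_iff_right (by simpa using hθ) ENNReal.ofReal_ne_top] at hmain

/-- The part of a small cap around `x` that lies in the same orthant as `x`, at distance
comparable to `|x j| + θ` from the coordinate hyperplanes. -/
def innerCap (η c : ℝ) (x : E d) (θ : ℝ) : Set (S d) :=
  {y | ‖(y : E d) - x‖ ≤ η * θ ∧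
    ∀ j, 0 ≤ x j * (y : E d) j ∧ c * (|x j| + θ) ≤ |(y : E d) j|}

theorem measurableSet_innerCap (η c : ℝ) (x : E d) (θ : ℝ) :
    MeasurableSet (innerCap η c x θ) := by
  have : innerCap η c x θ = {y : S d | ‖(y : E d) - x‖ ≤ η * θ} ∩
      ⋂ j, ({y : S d | 0 ≤ x j * (y : E d) j} ∩ {y : S d | c * (|x j| + θ) ≤ |(y : E d) j|}) := by
    ext y; simp [innerCap]
  rw [this]
  refine (measurableSet_le (by fun_prop) (by fun_prop)).inter (MeasurableSet.iInter fun j => ?_)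
  exact (measurableSet_le (by fun_prop) (by fun_prop)).inter
    (measurableSet_le (by fun_prop) (by fun_prop))

/-- Lower bound for the surface measure of an inner cap. -/
theorem exists_le_surface_innerCap (d : ℕ) {η : ℝ} (hη : 0 < η) :
    ∃ c : ℝ, 0 < c ∧ ∀ (x : S d) (θ : ℝ), 0 < θ → θ ≤ Real.pi →
      ENNReal.ofReal (c * θ ^ d) ≤ surface d (innerCap η c (x : E d) θ) := by
  -- A box at distance at most bθ from x projects radially to within 2bθ of x, so a is chosen to
  -- make 2b ≤ η.
  set a : ℝ := min 1 (η / (4 * (d + 1))) with ha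
  have ha0 : 0 < a := by positivity
  have ha1 : a ≤ 1 := min_le_left _ _
  set b : ℝ := 2 * (d + 1) * a with hb
  have hb0 : 0 < b := by positivity
  have hbη : 2 * b ≤ η := by
    have : a ≤ η / (4 * (d + 1)) := min_le_right _ _
    rw [le_div_iff₀ (by positivity)] at this
    rw [hb]; linarith
  set K : ℝ := 1 + b * Real.pi with hK
  have hK0 : 0 < K := by positivity
  set c : ℝ := min (a / K) (a ^ (d + 1) / (b * K ^ d)) with hc
  have hc0 : 0 < c := by positivity
  refine ⟨c, hc0, fun x θ hθ hθπ => ?_⟩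
  set G := innerCap η c (x : E d) θ with hG
  have hbθ : 1 + b * θ ≤ K := by rw [hK]; gcongr
  -- The box of side aθ is shifted away from 0 in every coordinate, staying in the closed orthant of
  -- x. Hence its points have norm at least 1, and their coordinates dominate |x_j| + aθ in absolute
  -- value.
  set l : Fin (d + 1) → ℝ := fun j =>
    if 0 ≤ (x : E d) j then (x : E d) j + a * θ else (x : E d) j - 2 * (a * θ) with hl
  set Q : Set (E d) := {z | ∀ j, z j ∈ Set.Icc (l j) (l j + a * θ)} with hQ
  have haθ : 0 < a * θ := by positivity
  have hQz : ∀ z ∈ Q, ∀ j, |z j - (x : E d) j| ≤ 2 * (a * θ) ∧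
      |(x : E d) j| + a * θ ≤ |z j| ∧ 0 ≤ (x : E d) j * z j := by
    intro z hz j
    have h1 := hz j
    simp only [hl] at h1
    split_ifs at h1 with h
    · obtain ⟨h2, h3⟩ := h1
      have hz0 : 0 ≤ z j := by linarith
      refine ⟨abs_le.2 ⟨by linarith, by linarith⟩, ?_, by positivity⟩
      rw [abs_of_nonneg h, abs_of_nonneg hz0]
      exact h2
    · obtain ⟨h2, h3⟩ := h1
      push Not at h
      have hz0 : z j ≤ 0 := by linarith
      refine ⟨abs_le.2 ⟨by linarith, by linarith⟩, ?_, mul_nonneg_of_nonpos_of_nonpos h.le hz0⟩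
      rw [abs_of_neg h, abs_of_nonpos hz0]
      linarith
  have hvol : volume Q = ENNReal.ofReal ((a * θ) ^ (d + 1)) := by
    rw [hQ, volume_euclidean_box]
    simp only [add_sub_cancel_left, Finset.prod_const, Finset.card_univ, Fintype.card_fin]
    rw [ENNReal.ofReal_pow haθ.le]
  have hQm : MeasurableSet Q := by
    have : Q = ⋂ j, (fun z : E d => z j) ⁻¹' Set.Icc (l j) (l j + a * θ) := by
      ext z; simp [hQ]
    rw [this]
    exact MeasurableSet.iInter fun j => (by fun_prop : Measurable fun z : E d => z j)
      measurableSet_Icc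
  have hkey : ∀ (ω : S d) (r : ℝ), 0 < r → r • (ω : E d) ∈ Q →
      r ∈ Set.Icc 1 (1 + b * θ) ∧ ω ∈ G := by
    intro ω r hr hrω
    have hz := hQz _ hrω
    have hnorm : ‖r • (ω : E d)‖ = r := by
      rw [norm_smul, norm_coe_eq_one, mul_one, Real.norm_of_nonneg hr.le]
    have hdist : ‖r • (ω : E d) - (x : E d)‖ ≤ b * θ := by
      refine (norm_le_mul_of_forall_abs_le (by positivity) fun j => (hz j).1).trans (le_of_eq ?_)
      rw [hb]; ring
    have hr1 : 1 ≤ r := by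
      have h1 : (1 : ℝ) ≤ r ^ 2 := by
        rw [← hnorm, EuclideanSpace.real_norm_sq_eq]
        refine (sum_sq_eq_one x).symm.le.trans ?_
        refine Finset.sum_le_sum fun j _ => sq_le_sq.2 ?_
        linarith [(hz j).2.1]
      nlinarith
    have hr2 : r ≤ 1 + b * θ := by
      calc r = ‖(x : E d) + (r • (ω : E d) - (x : E d))‖ := by rw [add_sub_cancel, hnorm]
        _ ≤ 1 + b * θ := (norm_add_le _ _).trans (by rw [norm_coe_eq_one]; linarith)
    refine ⟨⟨hr1, hr2⟩, ?_, fun j => ?_⟩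
    · calc ‖(ω : E d) - x‖ = ‖((1 - r) • (ω : E d)) + (r • (ω : E d) - (x : E d))‖ := by
            congr 1
            rw [sub_smul, one_smul]
            abel
        _ ≤ ‖(1 - r) • (ω : E d)‖ + ‖r • (ω : E d) - (x : E d)‖ := norm_add_le _ _
        _ ≤ b * θ + b * θ := by
            refine add_le_add ?_ hdist
            rw [norm_smul, norm_coe_eq_one, mul_one, Real.norm_eq_abs, abs_le]
            constructor <;> linarith
        _ = 2 * b * θ := by ring
        _ ≤ η * θ := by gcongr
    · have h2 := (hz j).2.1
      have h3 := (hz j).2.2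
      rw [PiLp.smul_apply, smul_eq_mul] at h2 h3
      constructor
      · rw [mul_left_comm] at h3
        exact nonneg_of_mul_nonneg_right h3 hr
      · rw [abs_mul, abs_of_pos hr] at h2
        have h4 : a * (|(x : E d) j| + θ) ≤ K * |(ω : E d) j| := by
          calc a * (|(x : E d) j| + θ) ≤ |(x : E d) j| + a * θ := by
                nlinarith [abs_nonneg ((x : E d) j)]
            _ ≤ r * |(ω : E d) j| := h2
            _ ≤ K * |(ω : E d) j| := by gcongr; linarith
        calc c * (|(x : E d) j| + θ) ≤ a / K * (|(x : E d) j| + θ) := by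
              gcongr; exact min_le_left _ _
          _ = a * (|(x : E d) j| + θ) / K := by ring
          _ ≤ _ := by rwa [div_le_iff₀' hK0]
  -- A ray from the origin meets Q only for 1 ≤ r ≤ 1 + bθ, and only if its direction lies in G.
  have hmain : volume Q ≤ ENNReal.ofReal (b * θ * K ^ d) * surface d G := by
    calc volume Q = ∫⁻ z, Q.indicator 1 z := by rw [lintegral_indicator_one hQm]
      _ = ∫⁻ ω : S d, (∫⁻ r in Set.Ioi (0 : ℝ),
            ENNReal.ofReal (r ^ d) * Q.indicator 1 (r • (ω : E d))) ∂(surface d) :=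
          lintegral_eq_lintegral_surface (measurable_one.indicator hQm)
      _ ≤ ∫⁻ ω : S d, G.indicator (fun _ => ENNReal.ofReal (b * θ * K ^ d)) ω ∂(surface d) := by
          refine lintegral_mono fun ω => ?_
          by_cases hω : ω ∈ G
          · rw [Set.indicator_of_mem hω]
            calc _ ≤ ∫⁻ r in Set.Ioi (0 : ℝ),
                  (Set.Icc 1 (1 + b * θ)).indicator (fun _ => ENNReal.ofReal (K ^ d)) r := by
                  refine setLIntegral_mono' measurableSet_Ioi fun r hr => ?_
                  by_cases hrQ : r • (ω : E d) ∈ Q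
                  · have h5 := (hkey ω r hr hrQ).1
                    rw [Set.indicator_of_mem hrQ, Set.indicator_of_mem h5, Pi.one_apply, mul_one]
                    refine ENNReal.ofReal_le_ofReal (pow_le_pow_left₀ (le_of_lt hr) ?_ d)
                    exact h5.2.trans hbθ
                  · rw [Set.indicator_of_notMem hrQ, mul_zero]
                    exact zero_le
              _ ≤ ∫⁻ r, (Set.Icc 1 (1 + b * θ)).indicator (fun _ => ENNReal.ofReal (K ^ d)) r :=
                  setLIntegral_le_lintegral _ _
              _ = _ := by
                  rw [lintegral_indicator_const measurableSet_Icc, Real.volume_Icc,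
                    add_sub_cancel_left, ← ENNReal.ofReal_mul (by positivity), mul_comm]
          · rw [Set.indicator_of_notMem hω, nonpos_iff_eq_zero]
            refine setLIntegral_eq_zero measurableSet_Ioi fun r hr => ?_
            rw [Set.indicator_of_notMem fun h => hω (hkey ω r hr h).2, mul_zero, Pi.zero_apply]
      _ = _ := lintegral_indicator_const (measurableSet_innerCap _ _ _ _) _
  rw [hvol] at hmain
  have hpos : 0 < b * θ * K ^ d := by positivity
  calc ENNReal.ofReal (c * θ ^ d) ≤ ENNReal.ofReal ((a * θ) ^ (d + 1) / (b * θ * K ^ d)) := by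
        refine ENNReal.ofReal_le_ofReal ?_
        calc c * θ ^ d ≤ a ^ (d + 1) / (b * K ^ d) * θ ^ d := by gcongr; exact min_le_right _ _
          _ = _ := by rw [mul_pow, pow_succ θ d]; field_simp
    _ ≤ _ := by
        rw [ENNReal.ofReal_div_of_pos hpos]
        exact ENNReal.div_le_of_le_mul' hmain

end Balls

/-! ### Two-sided kernel bounds and domination by the ball maximal function. -/

section Kernel

variable {d : ℕ}

/-- The measure on `[-1,1]^{d+1}` that represents `V κ`. -/
abbrev cubeMeasure (κ : Fin (d + 1) → ℝ) : Measure (Fin (d + 1) → ℝ) :=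
  Measure.pi fun i => factorMeasure (κ i)

/-- The pointwise product of `y` and `t`, as a point of Euclidean space. -/
abbrev hadamard (y : E d) (t : Fin (d + 1) → ℝ) : E d := WithLp.toLp 2 fun i => y i * t i

theorem isProbabilityMeasure_cubeMeasure {κ : Fin (d + 1) → ℝ} (hκ : ∀ j, 0 ≤ κ j) :
    IsProbabilityMeasure (cubeMeasure κ) := by
  have := fun j => isProbabilityMeasure_factorMeasure (hκ j)
  infer_instance

theorem measurable_hadamard : Measurable fun p : E d × (Fin (d + 1) → ℝ) => hadamard p.1 p.2 := by
  unfold hadamard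
  fun_prop

theorem measurableSet_solidCap (x : E d) (θ : ℝ) : MeasurableSet (solidCap x θ) := by
  have h1 : MeasurableSet {y : E d | ‖y‖ ≤ 1} := measurableSet_le (by fun_prop) (by fun_prop)
  have h2 : MeasurableSet {y : E d | Real.cos θ ≤ inner ℝ x y} :=
    measurableSet_le (by fun_prop) (by fun_prop)
  exact h1.inter h2

theorem kernel_eq_measureReal (κ : Fin (d + 1) → ℝ) (x : E d) (θ : ℝ) (y : E d) :
    kernel κ x θ y = (cubeMeasure κ).real (hadamard y ⁻¹' solidCap x θ) := by
  have hm : Measurable (hadamard y) := by unfold hadamard; fun_prop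
  rw [kernel, V, ← integral_indicator_one (hm (measurableSet_solidCap x θ))]
  rfl

theorem ofReal_kernel {κ : Fin (d + 1) → ℝ} (hκ : ∀ j, 0 ≤ κ j) (x : E d) (θ : ℝ) (y : E d) :
    ENNReal.ofReal (kernel κ x θ y) = cubeMeasure κ (hadamard y ⁻¹' solidCap x θ) := by
  have := isProbabilityMeasure_cubeMeasure hκ
  rw [kernel_eq_measureReal, ofReal_measureReal]

theorem ae_cubeMeasure_mem_Icc {κ : Fin (d + 1) → ℝ} (hκ : ∀ j, 0 ≤ κ j) :
    ∀ᵐ t ∂(cubeMeasure κ), ∀ j, t j ∈ Set.Icc (-1 : ℝ) 1 := by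
  have := fun j => isProbabilityMeasure_factorMeasure (hκ j)
  rw [ae_all_iff]
  exact fun j => (Measure.tendsto_eval_ae_ae (i := j)).eventually (ae_factorMeasure_mem_Icc (κ j))

theorem inner_hadamard (x y : E d) (t : Fin (d + 1) → ℝ) :
    inner ℝ x (hadamard y t) = ∑ j, x j * y j * t j := by
  rw [PiLp.inner_apply]
  refine Finset.sum_congr rfl fun j _ => ?_
  simp only [RCLike.inner_apply, conj_trivial]
  ring

theorem inner_eq_sum (x y : E d) : inner ℝ x y = ∑ j, x j * y j := by
  rw [PiLp.inner_apply]
  refine Finset.sum_congr rfl fun j _ => ?_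
  simp [mul_comm]

theorem sum_abs_mul_le_one (x y : S d) : ∑ j, |(x : E d) j * (y : E d) j| ≤ 1 := by
  have h : ∀ j, |(x : E d) j * (y : E d) j| ≤ (((x : E d) j) ^ 2 + ((y : E d) j) ^ 2) / 2 := by
    intro j
    rw [abs_mul]
    nlinarith [sq_nonneg (|(x : E d) j| - |(y : E d) j|), sq_abs ((x : E d) j),
      sq_abs ((y : E d) j)]
  refine (Finset.sum_le_sum fun j _ => h j).trans (le_of_eq ?_)
  rw [← Finset.sum_div, Finset.sum_add_distrib, sum_sq_eq_one, sum_sq_eq_one]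
  norm_num

/-- On the sphere ∑ (|x_i| - |y_i|)² = 2 - 2 ∑ |x_i y_i| ≤ 2 - 2 cos θ ≤ θ². -/
theorem mem_absBall_of_cos_le {x y : S d} {θ : ℝ} (hθ : 0 < θ)
    (h : Real.cos θ ≤ ∑ j, |(x : E d) j * (y : E d) j|) : y ∈ absBall (x : E d) θ := by
  intro j
  refine abs_le_of_sq_le_sq ?_ hθ.le
  have h1 : ∑ i, (|(x : E d) i| - |(y : E d) i|) ^ 2 =
      2 - 2 * ∑ i, |(x : E d) i * (y : E d) i| := by
    have : ∀ i, (|(x : E d) i| - |(y : E d) i|) ^ 2 =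
        (x : E d) i ^ 2 + (y : E d) i ^ 2 - 2 * |(x : E d) i * (y : E d) i| := by
      intro i
      rw [abs_mul, sub_sq, sq_abs, sq_abs]
      ring
    simp only [this]
    rw [Finset.sum_sub_distrib, Finset.sum_add_distrib, sum_sq_eq_one, sum_sq_eq_one,
      Finset.mul_sum]
    norm_num
  have h2 := Finset.single_le_sum (f := fun i => (|(x : E d) i| - |(y : E d) i|) ^ 2)
    (fun i _ => sq_nonneg _) (Finset.mem_univ j)
  have h3 := Real.one_sub_sq_div_two_le_cos (x := θ)
  simp only [h1] at h2
  linarith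

theorem mul_le_abs_of_mem_Icc {p t : ℝ} (ht : t ∈ Set.Icc (-1 : ℝ) 1) : p * t ≤ |p| := by
  have h1 : |t| ≤ 1 := abs_le.2 ⟨ht.1, ht.2⟩
  calc p * t ≤ |p * t| := le_abs_self _
    _ = |p| * |t| := abs_mul _ _
    _ ≤ |p| := mul_le_of_le_one_right (abs_nonneg _) h1

/-- If |u| < 2θ, the right side is bounded below and total mass 1 suffices. Otherwise |v| ≥ |u|/2,
and t must lie within δ = θ²/(2|uv|) of the sign of uv, which has mass O(δ^k) with δ ≤
(3θ/(|u|+θ))². -/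
theorem exists_factorMeasure_slab_le {k : ℝ} (hk : 0 ≤ k) :
    ∃ C : ℝ, 0 < C ∧ ∀ u v θ : ℝ, 0 < θ → |(|u| - |v|)| ≤ θ →
      factorMeasure k {t | |u * v| - u * v * t ≤ θ ^ 2 / 2} ≤
        ENNReal.ofReal (C * (θ / (|u| + θ)) ^ (2 * k)) := by
  have := isProbabilityMeasure_factorMeasure hk
  obtain ⟨C, hC1, hC⟩ := exists_factorMeasure_le hk
  have hC0 : 0 < C := by linarith
  refine ⟨C * 3 ^ (2 * k), by positivity, fun u v θ hθ huv => ?_⟩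
  have hu := abs_nonneg u
  have h3 : (3 * (θ / (|u| + θ))) ^ (2 * k) = 3 ^ (2 * k) * (θ / (|u| + θ)) ^ (2 * k) :=
    Real.mul_rpow (by norm_num) (by positivity)
  rw [mul_assoc, ← h3]
  rcases lt_or_ge |u| (2 * θ) with h | h
  · refine prob_le_one.trans ?_
    rw [ENNReal.one_le_ofReal]
    have h4 : 1 ≤ 3 * (θ / (|u| + θ)) := by
      rw [← mul_div_assoc, le_div_iff₀ (by positivity)]
      linarith
    have h5 := Real.one_le_rpow h4 (by linarith : 0 ≤ 2 * k)
    nlinarith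
  · have hv : |u| / 2 ≤ |v| := by linarith [(abs_le.1 huv).2]
    have hp : 0 < |u * v| := by
      rw [abs_mul]
      exact mul_pos (by linarith) (by linarith)
    have hp2 : |u| ^ 2 / 2 ≤ |u * v| := by
      rw [abs_mul]
      nlinarith
    set δ := θ ^ 2 / (2 * |u * v|) with hδ
    have hδ0 : 0 < δ := by positivity
    have hδle : δ ≤ (3 * (θ / (|u| + θ))) ^ 2 := by
      have hu0 : 0 < |u| := by linarith
      rw [hδ, ← mul_div_assoc, div_pow, div_le_div_iff₀ (by positivity) (by positivity)]
      have h6 : (|u| + θ) ^ 2 ≤ 9 * (2 * |u * v|) := by nlinarith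
      nlinarith [mul_le_mul_of_nonneg_left h6 (sq_nonneg θ)]
    have hpow : C * δ ^ k ≤ C * (3 * (θ / (|u| + θ))) ^ (2 * k) := by
      rw [Real.rpow_mul (by positivity), Real.rpow_two]
      gcongr
    have hδm : |u * v| * δ = θ ^ 2 / 2 := by rw [hδ]; field_simp
    rcases abs_cases (u * v) with ⟨h7, _⟩ | ⟨h7, _⟩
    · refine (measure_mono fun t ht => ?_).trans
        ((hC δ hδ0).1.trans (ENNReal.ofReal_le_ofReal hpow))
      rw [Set.mem_ofPred_eq, ← hδm, ← h7, abs_abs] at ht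
      rw [Set.mem_Ici]
      have : |u * v| * (1 - t) ≤ |u * v| * δ := by linarith
      linarith [le_of_mul_le_mul_left this hp]
    · refine (measure_mono fun t ht => ?_).trans
        ((hC δ hδ0).2.trans (ENNReal.ofReal_le_ofReal hpow))
      rw [Set.mem_ofPred_eq, ← hδm, show u * v = -|u * v| by linarith, abs_neg, abs_abs] at ht
      rw [Set.mem_Iic]
      have : |u * v| * (1 + t) ≤ |u * v| * δ := by linarith
      linarith [le_of_mul_le_mul_left this hp]

/-- The decay factor of the kernel. -/
def decay (κ : Fin (d + 1) → ℝ) (x : E d) (θ : ℝ) : ℝ := ∏ j, (θ / (|x j| + θ)) ^ (2 * κ j)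

theorem decay_pos (κ : Fin (d + 1) → ℝ) (x : E d) {θ : ℝ} (hθ : 0 < θ) : 0 < decay κ x θ :=
  Finset.prod_pos fun _ _ => Real.rpow_pos_of_pos (div_pos hθ
    (add_pos_of_nonneg_of_pos (abs_nonneg _) hθ)) _

/-- Upper bound for the kernel. -/
theorem exists_kernel_le {κ : Fin (d + 1) → ℝ} (hκ : ∀ j, 0 ≤ κ j) :
    ∃ C : ℝ, 0 < C ∧ ∀ (x y : S d) (θ : ℝ), 0 < θ →
      ENNReal.ofReal (kernel κ (x : E d) θ (y : E d)) ≤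
        (absBall (x : E d) θ).indicator (fun _ => ENNReal.ofReal (C * decay κ (x : E d) θ)) y := by
  have := fun j => isProbabilityMeasure_factorMeasure (hκ j)
  have hex := fun j => exists_factorMeasure_slab_le (hκ j)
  choose C hC0 hC using hex
  refine ⟨∏ j, C j, Finset.prod_pos fun j _ => hC0 j, fun x y θ hθ => ?_⟩
  rw [ofReal_kernel hκ]
  by_cases hy : y ∈ absBall (x : E d) θ
  · rw [Set.indicator_of_mem hy]
    -- The terms |x_i y_i| - x_i y_i t_i are nonnegative with sum at most 1 - cos θ ≤ θ²/2, so each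
    -- one is. The cap condition thus implies a product of one-variable conditions.
    have hsub : cubeMeasure κ (hadamard (y : E d) ⁻¹' solidCap (x : E d) θ) ≤
        cubeMeasure κ (Set.univ.pi fun j =>
          {t | |(x : E d) j * (y : E d) j| - (x : E d) j * (y : E d) j * t ≤ θ ^ 2 / 2}) := by
      refine measure_mono_ae ?_
      filter_upwards [ae_cubeMeasure_mem_Icc hκ] with t ht hmem j _
      have h1 : Real.cos θ ≤ inner ℝ (x : E d) (hadamard (y : E d) t) := hmem.2
      rw [inner_hadamard] at h1
      have h2 := Finset.single_le_sum (f := fun i => |(x : E d) i * (y : E d) i| -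
        (x : E d) i * (y : E d) i * t i)
        (fun i _ => sub_nonneg.2 (mul_le_abs_of_mem_Icc (ht i))) (Finset.mem_univ j)
      simp only [Finset.sum_sub_distrib] at h2
      have h3 := Real.one_sub_sq_div_two_le_cos (x := θ)
      have h4 := sum_abs_mul_le_one x y
      rw [Set.mem_ofPred_eq]
      linarith
    refine hsub.trans ?_
    rw [Measure.pi_pi, decay, ← Finset.prod_mul_distrib,
      ENNReal.ofReal_prod_of_nonneg fun j _ => mul_nonneg (hC0 j).le (by positivity)]
    exact Finset.prod_le_prod' fun j _ => hC j _ _ θ hθ (hy j)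
  · rw [Set.indicator_of_notMem hy, nonpos_iff_eq_zero, measure_eq_zero_iff_ae_notMem]
    filter_upwards [ae_cubeMeasure_mem_Icc hκ] with t ht hmem
    refine hy (mem_absBall_of_cos_le hθ ?_)
    have h1 : Real.cos θ ≤ inner ℝ (x : E d) (hadamard (y : E d) t) := hmem.2
    rw [inner_hadamard] at h1
    exact h1.trans (Finset.sum_le_sum fun j _ => mul_le_abs_of_mem_Icc (ht j))

theorem norm_hadamard_le (y : S d) {t : Fin (d + 1) → ℝ} (ht : ∀ j, t j ∈ Set.Icc (-1 : ℝ) 1) :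
    ‖hadamard (y : E d) t‖ ≤ 1 := by
  rw [EuclideanSpace.norm_eq, Real.sqrt_le_left zero_le_one, one_pow]
  refine le_trans ?_ (sum_sq_eq_one y).le
  refine Finset.sum_le_sum fun j _ => ?_
  have h1 : |t j| ≤ 1 := abs_le.2 ⟨(ht j).1, (ht j).2⟩
  rw [Real.norm_eq_abs, sq_abs, mul_pow]
  exact mul_le_of_le_one_right (sq_nonneg _) ((sq_le_one_iff_abs_le_one _).2 h1)

/-- Caps the loss in one coordinate of the inner product when t_j drops below 1 by a multiple of
(θ/(|x_j|+θ))². -/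
theorem le_decay_factor_abs {u v θ : ℝ} (hθ : 0 < θ) (h : |v - u| ≤ θ) :
    u * v * (θ / (|u| + θ)) ^ 2 ≤ θ ^ 2 := by
  have hu := abs_nonneg u
  have h1 : |v| ≤ |u| + θ := by
    have := abs_add_le u (v - u)
    rw [add_sub_cancel] at this
    linarith
  have h2 : u * v ≤ (|u| + θ) ^ 2 := by
    calc u * v ≤ |u * v| := le_abs_self _
      _ = |u| * |v| := abs_mul _ _
      _ ≤ (|u| + θ) * (|u| + θ) := by gcongr; linarith
      _ = _ := by ring
  calc u * v * (θ / (|u| + θ)) ^ 2 ≤ (|u| + θ) ^ 2 * (θ / (|u| + θ)) ^ 2 := by gcongr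
    _ = θ ^ 2 := by rw [← mul_pow, mul_div_cancel₀ _ (by positivity)]

/-- Lower bound for the kernel near the centre of the cap. -/
theorem exists_le_kernel {κ : Fin (d + 1) → ℝ} (hκ : ∀ j, 0 ≤ κ j) :
    ∃ c : ℝ, 0 < c ∧ ∀ (x y : S d) (θ : ℝ), 0 < θ → θ ≤ Real.pi →
      ‖(y : E d) - x‖ ≤ 1 / Real.pi * θ → (∀ j, 0 ≤ (x : E d) j * (y : E d) j) →
      ENNReal.ofReal (c * decay κ (x : E d) θ) ≤
        ENNReal.ofReal (kernel κ (x : E d) θ (y : E d)) := by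
  have := fun j => isProbabilityMeasure_factorMeasure (hκ j)
  have hex := fun j => exists_le_factorMeasure_Ici (hκ j)
  choose c hc0 hc using hex
  have hπ := Real.pi_gt_three
  -- On (0,π], cos θ ≤ 1 - 2θ²/π². One share θ²/π² pays for the distance from y to x, the other for
  -- d + 1 coordinate losses of aθ² each.
  set a : ℝ := 1 / (Real.pi ^ 2 * (d + 1)) with ha
  have ha0 : 0 < a := by positivity
  have hd : (1 : ℝ) ≤ d + 1 := by
    have : (0 : ℝ) ≤ d := Nat.cast_nonneg d
    linarith
  have ha1 : a ≤ 1 := by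
    rw [ha, div_le_one (by positivity)]
    nlinarith
  refine ⟨∏ j, c j * a ^ κ j, Finset.prod_pos fun j _ => mul_pos (hc0 j) (by positivity),
    fun x y θ hθ hθπ hxy hpos => ?_⟩
  rw [ofReal_kernel hκ]
  set q : Fin (d + 1) → ℝ := fun j => θ / (|(x : E d) j| + θ) with hq
  have hq0 : ∀ j, 0 < q j := fun j => by
    have := abs_nonneg ((x : E d) j)
    simp only [hq]; positivity
  have hq1 : ∀ j, q j ≤ 1 := fun j => by
    have := abs_nonneg ((x : E d) j)
    simp only [hq]
    rw [div_le_one (by positivity)]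
    linarith
  have hsub : cubeMeasure κ (Set.univ.pi fun j => Set.Ici (1 - a * q j ^ 2)) ≤
      cubeMeasure κ (hadamard (y : E d) ⁻¹' solidCap (x : E d) θ) := by
    refine measure_mono_ae ?_
    filter_upwards [ae_cubeMeasure_mem_Icc hκ] with t ht hmem
    refine ⟨norm_hadamard_le y ht, ?_⟩
    rw [inner_hadamard]
    have h1 : ∀ j, (x : E d) j * (y : E d) j - a * θ ^ 2 ≤ (x : E d) j * (y : E d) j * t j := by
      intro j
      have h2 : 1 - a * q j ^ 2 ≤ t j := hmem j (Set.mem_univ j)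
      have h3 : |(y : E d) j - (x : E d) j| ≤ θ := by
        have h4 := PiLp.norm_apply_le ((y : E d) - (x : E d)) j
        rw [Real.norm_eq_abs, PiLp.sub_apply] at h4
        refine h4.trans (hxy.trans ?_)
        refine mul_le_of_le_one_left hθ.le ?_
        rw [div_le_one (by positivity)]
        linarith
      have h5 := mul_le_mul_of_nonneg_left (le_decay_factor_abs hθ h3) ha0.le
      have h6 := mul_le_mul_of_nonneg_left h2 (hpos j)
      simp only [hq] at h6
      nlinarith
    have h2 : inner ℝ (x : E d) (y : E d) - (d + 1) * (a * θ ^ 2) ≤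
        ∑ j, (x : E d) j * (y : E d) j * t j := by
      rw [inner_eq_sum]
      calc _ = ∑ j, ((x : E d) j * (y : E d) j - a * θ ^ 2) := by
            rw [Finset.sum_sub_distrib]; simp
        _ ≤ _ := Finset.sum_le_sum fun j _ => h1 j
    have h3 : (d + 1) * (a * θ ^ 2) = 1 / Real.pi ^ 2 * θ ^ 2 := by
      rw [ha]; field_simp
    have h4 : 1 - 1 / Real.pi ^ 2 * θ ^ 2 ≤ inner ℝ (x : E d) (y : E d) := by
      have h5 := norm_sub_sq_real (y : E d) (x : E d)
      rw [norm_coe_eq_one, norm_coe_eq_one, real_inner_comm] at h5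
      have h6 : ‖(y : E d) - x‖ ^ 2 ≤ 1 / Real.pi ^ 2 * θ ^ 2 := by
        calc ‖(y : E d) - x‖ ^ 2 ≤ (1 / Real.pi * θ) ^ 2 := by gcongr
          _ = _ := by ring
      have h7 : 0 ≤ 1 / Real.pi ^ 2 * θ ^ 2 := by positivity
      linarith
    have h5 := Real.cos_le_one_sub_mul_cos_sq (x := θ) (by rwa [abs_of_pos hθ])
    have h6 : 2 / Real.pi ^ 2 * θ ^ 2 = 1 / Real.pi ^ 2 * θ ^ 2 + 1 / Real.pi ^ 2 * θ ^ 2 := by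
      ring
    linarith
  refine le_trans ?_ hsub
  rw [Measure.pi_pi, decay, ← Finset.prod_mul_distrib, ENNReal.ofReal_prod_of_nonneg fun j _ =>
    mul_nonneg (mul_nonneg (hc0 j).le (by positivity)) (by positivity)]
  refine Finset.prod_le_prod' fun j _ => ?_
  have h1 : a * q j ^ 2 ≤ 1 :=
    mul_le_one₀ ha1 (sq_nonneg _) (pow_le_one₀ (hq0 j).le (hq1 j))
  refine le_trans (le_of_eq ?_) (hc j (a * q j ^ 2) (mul_nonneg ha0.le (sq_nonneg _)) h1)
  rw [Real.mul_rpow ha0.le (sq_nonneg _), ← Real.rpow_two, ← Real.rpow_mul (hq0 j).le, mul_assoc]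

/-- Lower bound for the denominator in the maximal function. -/
theorem exists_le_lintegral_kernel {κ : Fin (d + 1) → ℝ} (hκ : ∀ j, 0 ≤ κ j) :
    ∃ c : ℝ, 0 < c ∧ ∀ (x : S d) (θ : ℝ), 0 < θ → θ ≤ Real.pi →
      ENNReal.ofReal (c * (decay κ (x : E d) θ * ballSize κ (x : E d) θ)) ≤
        ∫⁻ y, ENNReal.ofReal (kernel κ (x : E d) θ (y : E d)) ∂(weightedMeasure κ) := by
  obtain ⟨a, ha0, ha⟩ := exists_le_surface_innerCap d (η := 1 / Real.pi) (by positivity)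
  obtain ⟨b, hb0, hb⟩ := exists_le_kernel hκ
  have hp : 0 < ∏ j, a ^ (2 * κ j) := Finset.prod_pos fun j _ => by positivity
  refine ⟨b * (∏ j, a ^ (2 * κ j)) * a, by positivity, fun x θ hθ hθπ => ?_⟩
  -- On G the kernel is at least a multiple of the decay factor, and h_κ² is at least a multiple of
  -- ∏ (|x_j|+θ)^{2κ_j} because κ_j ≥ 0; the surface measure of G is at least a multiple of θ^d.
  set G := innerCap (1 / Real.pi) a (x : E d) θ with hG
  have hGm : MeasurableSet G := measurableSet_innerCap _ _ _ _
  have hdec := decay_pos κ (x : E d) hθ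
  have hP : 0 ≤ ∏ j, (|(x : E d) j| + θ) ^ (2 * κ j) := Finset.prod_nonneg fun j _ => by positivity
  have hw : ∀ y ∈ G, ENNReal.ofReal ((∏ j, a ^ (2 * κ j)) * ∏ j, (|(x : E d) j| + θ) ^ (2 * κ j)) ≤
      ENNReal.ofReal (weight κ (y : E d) ^ 2) := by
    intro y hy
    refine ENNReal.ofReal_le_ofReal ?_
    rw [weight_sq, ← Finset.prod_mul_distrib]
    refine Finset.prod_le_prod (fun j _ => by positivity) fun j _ => ?_
    rw [← Real.mul_rpow ha0.le (by positivity)]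
    exact Real.rpow_le_rpow (by positivity) (hy.2 j).2 (by linarith [hκ j])
  calc ENNReal.ofReal (b * (∏ j, a ^ (2 * κ j)) * a *
        (decay κ (x : E d) θ * ballSize κ (x : E d) θ))
      = ENNReal.ofReal (b * decay κ (x : E d) θ) *
          (ENNReal.ofReal ((∏ j, a ^ (2 * κ j)) * ∏ j, (|(x : E d) j| + θ) ^ (2 * κ j)) *
            ENNReal.ofReal (a * θ ^ d)) := by
        rw [← ENNReal.ofReal_mul (by positivity), ← ENNReal.ofReal_mul (by positivity), ballSize]
        congr 1
        ring
    _ ≤ ENNReal.ofReal (b * decay κ (x : E d) θ) *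
          (ENNReal.ofReal ((∏ j, a ^ (2 * κ j)) * ∏ j, (|(x : E d) j| + θ) ^ (2 * κ j)) *
            surface d G) := by
        gcongr
        exact ha x θ hθ hθπ
    _ ≤ ENNReal.ofReal (b * decay κ (x : E d) θ) * weightedMeasure κ G := by
        gcongr
        rw [weightedMeasure, withDensity_apply _ hGm, ← setLIntegral_const]
        exact setLIntegral_mono' hGm hw
    _ = ∫⁻ _ in G, ENNReal.ofReal (b * decay κ (x : E d) θ) ∂(weightedMeasure κ) :=
        (setLIntegral_const _ _).symm
    _ ≤ ∫⁻ y in G, ENNReal.ofReal (kernel κ (x : E d) θ (y : E d)) ∂(weightedMeasure κ) :=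
        setLIntegral_mono' hGm fun y hy => hb x y θ hθ hθπ hy.1 fun j => (hy.2 j).1
    _ ≤ _ := setLIntegral_le_lintegral _ _

/-- The Hardy–Littlewood type maximal function for `h_τ² dω` and the balls `absBall`. -/
def ballMaximal (τ : Fin (d + 1) → ℝ) (g : S d → ℝ≥0∞) (x : S d) : ℝ≥0∞ :=
  ⨆ θ ∈ Set.Ioc (0 : ℝ) Real.pi,
    (∫⁻ y in absBall (x : E d) θ, g y ∂(weightedMeasure τ)) /
      ENNReal.ofReal (ballSize τ (x : E d) θ)

/-- The decay factor in the upper bound for the numerator cancels the one in the lower bound for the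
denominator. -/
theorem exists_maximal_le_ballMaximal {κ : Fin (d + 1) → ℝ} (hκ : ∀ j, 0 ≤ κ j) :
    ∃ C : ℝ≥0, ∀ (f : S d → ℝ) (x : S d),
      maximal κ f x ≤ C * ballMaximal κ (fun y => ‖f y‖ₑ) x := by
  obtain ⟨C, hC0, hC⟩ := exists_kernel_le hκ
  obtain ⟨c, hc0, hc⟩ := exists_le_lintegral_kernel hκ
  refine ⟨(C / c).toNNReal, fun f x => ?_⟩
  refine iSup₂_le fun θ hθ => ?_
  have hdec := decay_pos κ (x : E d) hθ.1
  have hsize := ballSize_pos κ (x : E d) hθ.1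
  set I := ∫⁻ y in absBall (x : E d) θ, ‖f y‖ₑ ∂(weightedMeasure κ) with hI
  have hN : ∫⁻ y, ‖f y‖ₑ * ENNReal.ofReal (kernel κ (x : E d) θ (y : E d)) ∂(weightedMeasure κ) ≤
      I * ENNReal.ofReal (C * decay κ (x : E d) θ) := by
    rw [hI, ← lintegral_mul_const' _ _ ENNReal.ofReal_ne_top,
      ← lintegral_indicator (measurableSet_absBall _ _)]
    refine lintegral_mono fun y => ?_
    refine (mul_le_mul_right (hC x y θ hθ.1) _).trans ?_
    by_cases hy : y ∈ absBall (x : E d) θ <;> simp [hy]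
  have hle : I / ENNReal.ofReal (ballSize κ (x : E d) θ) ≤
      ballMaximal κ (fun y => ‖f y‖ₑ) x :=
    le_iSup₂ (f := fun (θ : ℝ) (_ : θ ∈ Set.Ioc (0 : ℝ) Real.pi) =>
      (∫⁻ y in absBall (x : E d) θ, ‖f y‖ₑ ∂(weightedMeasure κ)) /
        ENNReal.ofReal (ballSize κ (x : E d) θ)) θ hθ
  calc _ ≤ I * ENNReal.ofReal (C * decay κ (x : E d) θ) /
        ENNReal.ofReal (c * (decay κ (x : E d) θ * ballSize κ (x : E d) θ)) :=
        ENNReal.div_le_div hN (hc x θ hθ.1 hθ.2)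
    _ = ENNReal.ofReal (C / c) * (I / ENNReal.ofReal (ballSize κ (x : E d) θ)) := by
        rw [mul_div_assoc, ← ENNReal.ofReal_div_of_pos (by positivity), div_eq_mul_inv I,
          ← ENNReal.ofReal_inv_of_pos hsize, mul_left_comm _ I, ← ENNReal.ofReal_mul (by positivity)]
        congr 2
        field_simp
    _ ≤ _ := by gcongr; rfl

end Kernel

/-! ### Null sets and finiteness of the weighted measures. -/

section NullSets

variable {d : ℕ}

open scoped Pointwise in
-- The cone over the exceptional set lies in a hyperplane. Adding exponents of |y_j| may fail at 0,
-- so identities between weights are used off this null set.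
theorem ae_surface_ne_zero (d : ℕ) : ∀ᵐ x : S d ∂(surface d), ∀ j, (x : E d) j ≠ 0 := by
  rw [ae_all_iff]
  intro j
  rw [ae_iff]
  have hm : MeasurableSet {x : S d | ¬(x : E d) j ≠ 0} := by
    simp only [not_not]
    exact measurableSet_eq_fun (by fun_prop) (by fun_prop)
  rw [surface, Measure.toSphere_apply' _ hm]
  have hker : volume ((LinearMap.ker (EuclideanSpace.proj j : E d →L[ℝ] ℝ).toLinearMap :
      Submodule ℝ (E d)) : Set (E d)) = 0 := by
    refine Measure.addHaar_submodule _ _ fun htop => ?_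
    have h1 : (EuclideanSpace.single j (1 : ℝ) : E d) ∈
        LinearMap.ker (EuclideanSpace.proj j : E d →L[ℝ] ℝ).toLinearMap := by
      rw [htop]; trivial
    simp at h1
  have hsub : Set.Ioo (0 : ℝ) 1 • ((↑) '' {x : S d | ¬(x : E d) j ≠ 0}) ⊆
      ((LinearMap.ker (EuclideanSpace.proj j : E d →L[ℝ] ℝ).toLinearMap :
        Submodule ℝ (E d)) : Set (E d)) := by
    rintro _ ⟨r, _, _, ⟨x, hx, rfl⟩, rfl⟩
    have hx' : (x : E d) j = 0 := by simpa using hx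
    simp [hx']
  rw [measure_mono_null hsub hker, mul_zero]

theorem weightedMeasure_absolutelyContinuous (τ : Fin (d + 1) → ℝ) :
    weightedMeasure τ ≪ surface d := withDensity_absolutelyContinuous _ _

/-- The density is positive off the coordinate hyperplanes. Hence all the weighted measures share
their null sets, and almost-everywhere statements pass from τ to κ. -/
theorem surface_absolutelyContinuous (τ : Fin (d + 1) → ℝ) :
    surface d ≪ weightedMeasure τ := by
  refine withDensity_absolutelyContinuous' (measurable_weight_density τ).aemeasurable ?_
  filter_upwards [ae_surface_ne_zero d] with x hx
  rw [ne_eq, ENNReal.ofReal_eq_zero, not_le, weight_sq]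
  exact Finset.prod_pos fun j _ => Real.rpow_pos_of_pos (abs_pos.2 (hx j)) _

theorem setLIntegral_weightedMeasure (τ : Fin (d + 1) → ℝ) (g : S d → ℝ≥0∞) {A : Set (S d)}
    (hA : MeasurableSet A) :
    ∫⁻ y in A, g y ∂(weightedMeasure τ) =
      ∫⁻ y in A, ENNReal.ofReal (weight τ (y : E d) ^ 2) * g y ∂(surface d) := by
  rw [weightedMeasure, setLIntegral_withDensity_eq_setLIntegral_mul_non_measurable _
    (measurable_weight_density τ) _ hA (ae_of_all _ fun _ => ENNReal.ofReal_lt_top)]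
  rfl

theorem isFiniteMeasure_weightedMeasure {κ : Fin (d + 1) → ℝ} (hκ : ∀ j, -(1 / 2 : ℝ) < κ j) :
    IsFiniteMeasure (weightedMeasure κ) := by
  refine ⟨?_⟩
  rcases isEmpty_or_nonempty (S d) with h | ⟨⟨x⟩⟩
  · simp [Measure.eq_zero_of_isEmpty]
  obtain ⟨C, _, hC⟩ := exists_weightedMeasure_absBall_le hκ
  have huniv : (Set.univ : Set (S d)) = absBall (x : E d) (3 * 1) := by
    refine (Set.eq_univ_of_forall fun y j => ?_).symm
    have h1 := abs_coe_le_one x j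
    have h2 := abs_coe_le_one y j
    rw [abs_le]
    constructor <;> linarith [abs_nonneg ((x : E d) j), abs_nonneg ((y : E d) j)]
  rw [huniv]
  exact (hC x 1 one_pos (by linarith [Real.pi_gt_three])).trans_lt ENNReal.ofReal_lt_top

end NullSets

/-! ### Weak type and change of weight for the ball maximal function. -/

section BallMaximal

variable {d : ℕ}

theorem le_ballMaximal (τ : Fin (d + 1) → ℝ) (g : S d → ℝ≥0∞) (x : S d) {θ : ℝ}
    (hθ : θ ∈ Set.Ioc (0 : ℝ) Real.pi) :
    (∫⁻ y in absBall (x : E d) θ, g y ∂(weightedMeasure τ)) /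
      ENNReal.ofReal (ballSize τ (x : E d) θ) ≤ ballMaximal τ g x :=
  le_iSup₂ (f := fun (θ : ℝ) (_ : θ ∈ Set.Ioc (0 : ℝ) Real.pi) =>
    (∫⁻ y in absBall (x : E d) θ, g y ∂(weightedMeasure τ)) /
      ENNReal.ofReal (ballSize τ (x : E d) θ)) θ hθ

theorem mem_absBall_self (x : S d) {θ : ℝ} (hθ : 0 ≤ θ) : x ∈ absBall (x : E d) θ :=
  fun j => by simpa using hθ

/-- Only centres need covering, as the maximal function is centred; so tripling a ball suffices in
the covering lemma with ratio 2. -/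
theorem mem_absBall_of_inter_nonempty {x z : S d} {r s : ℝ} (hrs : r ≤ 2 * s)
    (h : (absBall (x : E d) r ∩ absBall (z : E d) s).Nonempty) :
    x ∈ absBall (z : E d) (3 * s) := by
  obtain ⟨y, hx, hz⟩ := h
  intro j
  have h1 := abs_le.1 (hx j)
  have h2 := abs_le.1 (hz j)
  rw [abs_le]
  constructor <;> linarith

/-- The ball maximal function is of weak type `(1,1)`. -/
theorem exists_weakType_ballMaximal {τ : Fin (d + 1) → ℝ} (hτ : ∀ j, -(1 / 2 : ℝ) < τ j) :
    ∃ C : ℝ≥0, ∀ (g : S d → ℝ≥0∞) (l : ℝ≥0∞),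
      l * weightedMeasure τ {x | l < ballMaximal τ g x} ≤ C * ∫⁻ y, g y ∂(weightedMeasure τ) := by
  obtain ⟨C, hC0, hC⟩ := exists_weightedMeasure_absBall_le hτ
  refine ⟨C.toNNReal, fun g l => ?_⟩
  set μ := weightedMeasure τ with hμ
  rcases eq_or_ne (∫⁻ y, g y ∂μ) ∞ with htop | hfin
  · rw [htop, ENNReal.mul_top (by simpa using hC0)]
    exact le_top
  rcases eq_or_ne l 0 with rfl | hl
  · simp
  set T : Set (S d × ℝ) := {a | a.2 ∈ Set.Ioc (0 : ℝ) Real.pi ∧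
    l * ENNReal.ofReal (ballSize τ (a.1 : E d) a.2) < ∫⁻ y in absBall (a.1 : E d) a.2, g y ∂μ}
    with hT
  obtain ⟨u, huT, hdisj, hcov⟩ := Vitali.exists_disjoint_subfamily_covering_enlargement
    (fun a : S d × ℝ => absBall (a.1 : E d) a.2) T (fun a => a.2) 2 one_lt_two
    (fun a ha => ha.1.1.le) Real.pi (fun a ha => ha.1.2)
    (fun a ha => ⟨a.1, mem_absBall_self _ ha.1.1.le⟩)
  -- The selected balls are disjoint, and the strict inequality in T gives each positive mass under
  -- the finite measure g dμ.
  have hcount : u.Countable := by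
    have hfinm : IsFiniteMeasure (μ.withDensity g) := isFiniteMeasure_withDensity hfin
    have := Measure.countable_meas_pos_of_disjoint_iUnion (μ := μ.withDensity g)
      (As := fun a : u => absBall (a.1.1 : E d) a.1.2)
      (fun a => measurableSet_absBall _ _)
      (fun a b hab => hdisj a.2 b.2 (fun h => hab (Subtype.ext h)))
    have huniv : {a : u | 0 < μ.withDensity g (absBall (a.1.1 : E d) a.1.2)} = Set.univ := by
      refine Set.eq_univ_of_forall fun a => ?_
      rw [Set.mem_ofPred_eq, withDensity_apply _ (measurableSet_absBall _ _)]
      exact lt_of_le_of_lt zero_le (huT a.2).2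
    rw [huniv, Set.countable_univ_iff] at this
    exact Set.countable_coe_iff.1 this
  have hsub : {x | l < ballMaximal τ g x} ⊆ ⋃ a ∈ u, absBall (a.1 : E d) (3 * a.2) := by
    intro x hx
    rw [Set.mem_ofPred_eq, ballMaximal] at hx
    simp only [lt_iSup_iff] at hx
    obtain ⟨θ, hθ, hlt⟩ := hx
    have hmem : (x, θ) ∈ T := by
      refine ⟨hθ, ?_⟩
      rwa [ENNReal.lt_div_iff_mul_lt (Or.inl (by simpa using ballSize_pos τ (x : E d) hθ.1))
        (Or.inl ENNReal.ofReal_ne_top)] at hlt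
    obtain ⟨b, hb, hne, hle⟩ := hcov _ hmem
    exact Set.mem_biUnion hb (mem_absBall_of_inter_nonempty hle hne)
  calc l * μ {x | l < ballMaximal τ g x}
      ≤ l * ∑' a : u, μ (absBall (a.1.1 : E d) (3 * a.1.2)) := by
        gcongr
        exact (measure_mono hsub).trans (measure_biUnion_le _ hcount _)
    _ = ∑' a : u, l * μ (absBall (a.1.1 : E d) (3 * a.1.2)) := ENNReal.tsum_mul_left.symm
    _ ≤ ∑' a : u, ENNReal.ofReal C * ∫⁻ y in absBall (a.1.1 : E d) a.1.2, g y ∂μ := by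
        refine ENNReal.tsum_le_tsum fun a => ?_
        have ha := huT a.2
        calc l * μ (absBall (a.1.1 : E d) (3 * a.1.2))
            ≤ l * ENNReal.ofReal (C * ballSize τ (a.1.1 : E d) a.1.2) := by
              gcongr
              exact hC _ _ ha.1.1 ha.1.2
          _ = ENNReal.ofReal C * (l * ENNReal.ofReal (ballSize τ (a.1.1 : E d) a.1.2)) := by
              rw [ENNReal.ofReal_mul hC0.le, mul_left_comm]
          _ ≤ _ := by gcongr; exact ha.2.le
    _ = ENNReal.ofReal C * ∫⁻ y in ⋃ a ∈ u, absBall (a.1 : E d) a.2, g y ∂μ := by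
        rw [ENNReal.tsum_mul_left, lintegral_biUnion hcount
          (fun a _ => measurableSet_absBall _ _) hdisj]
    _ ≤ _ := mul_le_mul_right (setLIntegral_le_lintegral _ _) _

theorem abs_le_of_mem_absBall {x y : S d} {θ : ℝ} (h : y ∈ absBall (x : E d) θ)
    (j : Fin (d + 1)) : |(y : E d) j| ≤ |(x : E d) j| + θ := by
  linarith [(abs_le.1 (h j)).1]

/-- On the ball |y_j| ≤ |x_j| + θ and κ_j - τ_j ≥ 0, so h_κ² ≤ P h_τ² almost everywhere, with P
exactly the ratio of the ball sizes. -/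
theorem ballMaximal_le_of_le {κ τ : Fin (d + 1) → ℝ} (hτκ : ∀ j, τ j ≤ κ j) (g : S d → ℝ≥0∞)
    (x : S d) : ballMaximal κ g x ≤ ballMaximal τ g x := by
  refine iSup₂_le fun θ hθ => le_trans ?_ (le_ballMaximal τ g x hθ)
  have hpos : ∀ j, 0 < |(x : E d) j| + θ := fun j =>
    add_pos_of_nonneg_of_pos (abs_nonneg _) hθ.1
  set P := ∏ j, (|(x : E d) j| + θ) ^ (2 * (κ j - τ j)) with hP
  have hP0 : 0 < P := Finset.prod_pos fun j _ => Real.rpow_pos_of_pos (hpos j) _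
  have hsize : ballSize κ (x : E d) θ = P * ballSize τ (x : E d) θ := by
    rw [hP, ballSize, ballSize, mul_left_comm, ← Finset.prod_mul_distrib]
    congr 1
    refine Finset.prod_congr rfl fun j _ => ?_
    rw [← Real.rpow_add (hpos j)]
    congr 1
    ring
  have hint : ∫⁻ y in absBall (x : E d) θ, g y ∂(weightedMeasure κ) ≤
      ENNReal.ofReal P * ∫⁻ y in absBall (x : E d) θ, g y ∂(weightedMeasure τ) := by
    rw [setLIntegral_weightedMeasure κ g (measurableSet_absBall _ _),
      setLIntegral_weightedMeasure τ g (measurableSet_absBall _ _),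
      ← lintegral_const_mul' _ _ ENNReal.ofReal_ne_top]
    refine setLIntegral_mono_ae' (measurableSet_absBall _ _) ?_
    filter_upwards [ae_surface_ne_zero d] with y hy hmem
    rw [← mul_assoc, ← ENNReal.ofReal_mul hP0.le, weight_sq, weight_sq, hP,
      ← Finset.prod_mul_distrib]
    gcongr with j
    · have h1 : |(y : E d) j| ^ (2 * κ j) =
          |(y : E d) j| ^ (2 * (κ j - τ j)) * |(y : E d) j| ^ (2 * τ j) := by
        rw [← Real.rpow_add (abs_pos.2 (hy j))]
        congr 1
        ring
      rw [h1]
      gcongr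
      · linarith [hτκ j]
      · exact abs_le_of_mem_absBall hmem j
  rw [hsize, ENNReal.ofReal_mul hP0.le]
  calc _ ≤ ENNReal.ofReal P * (∫⁻ y in absBall (x : E d) θ, g y ∂(weightedMeasure τ)) /
        (ENNReal.ofReal P * ENNReal.ofReal (ballSize τ (x : E d) θ)) := by gcongr
    _ = _ := ENNReal.mul_div_mul_left _ _ (by simpa using hP0) ENNReal.ofReal_ne_top

theorem prod_rpow_rpow {ι : Type*} (s : Finset ι) {a : ι → ℝ} (ha : ∀ j, 0 ≤ a j) (e : ι → ℝ)
    (p : ℝ) : (∏ j ∈ s, a j ^ e j) ^ p = ∏ j ∈ s, a j ^ (e j * p) := by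
  rw [← Real.finsetProd_rpow _ _ fun j _ => Real.rpow_nonneg (ha j) _]
  exact Finset.prod_congr rfl fun j _ => (Real.rpow_mul (ha j) _ _).symm

/-- Comparison of ball maximal functions for different weights by Hölder's inequality. -/
theorem exists_ballMaximal_le_rpow {κ τ : Fin (d + 1) → ℝ} {q : ℝ} (hq : 1 < q)
    (hτκ : ∀ j, τ j < q * κ j + (q - 1) / 2) :
    ∃ C : ℝ≥0, ∀ g : S d → ℝ≥0∞, Measurable g → ∀ x : S d,
      ballMaximal κ g x ≤ C * (ballMaximal τ (fun y => g y ^ q) x) ^ (1 / q) := by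
  have hconj : q.HolderConjugate q.conjExponent := Real.HolderConjugate.conjExponent hq
  set q' := q.conjExponent with hq'
  have hq0 : 0 < q := hconj.pos
  have hq'0 : 0 < q' := hconj.symm.pos
  have hinv : 1 / q + 1 / q' = 1 := by simpa using hconj.inv_add_inv_eq_one
  -- Chosen so that h_κ² = (h_τ²)^{1/q} (h_σ²)^{1/q'} off the coordinate hyperplanes. The condition
  -- σ_j > -1/2 is precisely τ_j < qκ_j + (q-1)/2.
  set σ : Fin (d + 1) → ℝ := fun j => (κ j - τ j / q) * q' with hσdef
  have hσ : ∀ j, -(1 / 2 : ℝ) < σ j := by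
    intro j
    have h1 : q' * (1 - 1 / q) = 1 := by
      rw [show 1 - 1 / q = 1 / q' by linarith]
      field_simp
    have h2 : -(1 / 2) * (1 - 1 / q) < κ j - τ j / q := by
      have h3 : τ j / q < κ j + (1 - 1 / q) / 2 := by
        rw [div_lt_iff₀ hq0]
        have : (κ j + (1 - 1 / q) / 2) * q = q * κ j + (q - 1) / 2 := by field_simp
        rw [this]
        exact hτκ j
      linarith
    calc -(1 / 2 : ℝ) = (-(1 / 2) * (1 - 1 / q)) * q' := by
          rw [mul_assoc, mul_comm _ q', h1, mul_one]
      _ < (κ j - τ j / q) * q' := by gcongr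
  obtain ⟨C, hC0, hC⟩ := exists_weightedMeasure_absBall_le hσ
  refine ⟨(C ^ (1 / q')).toNNReal, fun g hg x => iSup₂_le fun θ hθ => ?_⟩
  have hpos : ∀ j, 0 < |(x : E d) j| + θ := fun j =>
    add_pos_of_nonneg_of_pos (abs_nonneg _) hθ.1
  set B := absBall (x : E d) θ with hB
  have hBm : MeasurableSet B := measurableSet_absBall _ _
  set I := ∫⁻ y in B, g y ^ q ∂(weightedMeasure τ) with hI
  set H : S d → ℝ≥0∞ := fun y => ENNReal.ofReal (∏ j, |(y : E d) j| ^ (2 * (κ j - τ j / q)))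
    with hH
  set W : S d → ℝ≥0∞ := fun y => ENNReal.ofReal (weight τ (y : E d) ^ 2) ^ (1 / q) with hW
  have hHm : Measurable H := by
    rw [hH]
    exact (Finset.measurable_prod _ fun j _ => by fun_prop).ennreal_ofReal
  have hWm : Measurable W := (measurable_weight_density τ).pow_const _
  have hsplit : ∀ᵐ y : S d ∂(surface d), ENNReal.ofReal (weight κ (y : E d) ^ 2) * g y =
      (g y * W y) * H y := by
    filter_upwards [ae_surface_ne_zero d] with y hy
    have h1 : ENNReal.ofReal (weight κ (y : E d) ^ 2) = W y * H y := by
      simp only [hW, hH]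
      rw [ENNReal.ofReal_rpow_of_nonneg (sq_nonneg _) (by positivity), weight_sq, weight_sq,
        prod_rpow_rpow _ fun j => abs_nonneg _, ← ENNReal.ofReal_mul (by positivity),
        ← Finset.prod_mul_distrib]
      congr 1
      refine Finset.prod_congr rfl fun j _ => ?_
      rw [← Real.rpow_add (abs_pos.2 (hy j))]
      congr 1
      ring
    rw [h1, mul_comm, mul_assoc]
  have hfirst : ∫⁻ y in B, (g y * W y) ^ q ∂(surface d) = I := by
    rw [hI, setLIntegral_weightedMeasure τ _ hBm]
    refine lintegral_congr fun y => ?_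
    rw [ENNReal.mul_rpow_of_nonneg _ _ hq0.le]
    simp only [hW]
    rw [← ENNReal.rpow_mul, one_div, inv_mul_cancel₀ hq0.ne', ENNReal.rpow_one, mul_comm]
  have hsecond : ∫⁻ y in B, H y ^ q' ∂(surface d) ≤
      ENNReal.ofReal (C * ballSize σ (x : E d) θ) := by
    have h1 : ∫⁻ y in B, H y ^ q' ∂(surface d) = weightedMeasure σ B := by
      rw [weightedMeasure, withDensity_apply _ hBm]
      refine lintegral_congr fun y => ?_
      simp only [hH]
      rw [ENNReal.ofReal_rpow_of_nonneg (Finset.prod_nonneg fun j _ => by positivity) hq'0.le,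
        prod_rpow_rpow _ fun j => abs_nonneg _, weight_sq]
      congr 1
      refine Finset.prod_congr rfl fun j _ => ?_
      simp only [hσdef]
      congr 1
      ring
    rw [h1]
    refine (measure_mono (absBall_mono _ ?_)).trans (hC x θ hθ.1 hθ.2)
    linarith [hθ.1]
  have hN : ∫⁻ y in B, g y ∂(weightedMeasure κ) ≤
      I ^ (1 / q) * ENNReal.ofReal (C * ballSize σ (x : E d) θ) ^ (1 / q') := by
    rw [setLIntegral_weightedMeasure κ _ hBm, lintegral_congr_ae (ae_restrict_of_ae hsplit)]
    refine (ENNReal.lintegral_mul_le_Lp_mul_Lq ((surface d).restrict B) hconj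
      (hg.mul hWm).aemeasurable hHm.aemeasurable).trans ?_
    simp only [Pi.mul_apply]
    rw [hfirst]
    gcongr
  have hs1 := ballSize_pos σ (x : E d) hθ.1
  have hs2 := ballSize_pos τ (x : E d) hθ.1
  have hs3 := ballSize_pos κ (x : E d) hθ.1
  -- Ball sizes satisfy the same factorization as the weights, so Hölder's inequality loses only a
  -- constant.
  have hsize : ballSize σ (x : E d) θ ^ (1 / q') * ballSize τ (x : E d) θ ^ (1 / q) =
      ballSize κ (x : E d) θ := by
    have hP : ∀ ρ : Fin (d + 1) → ℝ, 0 ≤ ∏ j, (|(x : E d) j| + θ) ^ (2 * ρ j) := fun ρ =>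
      Finset.prod_nonneg fun j _ => Real.rpow_nonneg (hpos j).le _
    have hθd : 0 < θ ^ d := pow_pos hθ.1 d
    rw [ballSize, ballSize, ballSize, Real.mul_rpow hθd.le (hP σ), Real.mul_rpow hθd.le (hP τ),
      prod_rpow_rpow _ fun j => (hpos j).le, prod_rpow_rpow _ fun j => (hpos j).le,
      mul_mul_mul_comm, ← Real.rpow_add hθd, add_comm (1 / q'), hinv, Real.rpow_one,
      ← Finset.prod_mul_distrib]
    congr 1
    refine Finset.prod_congr rfl fun j _ => ?_
    rw [← Real.rpow_add (hpos j)]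
    congr 1
    simp only [hσdef]
    field_simp
    ring
  have hle := le_ballMaximal τ (fun y => g y ^ q) x hθ
  calc (∫⁻ y in B, g y ∂(weightedMeasure κ)) / ENNReal.ofReal (ballSize κ (x : E d) θ)
      ≤ I ^ (1 / q) * ENNReal.ofReal (C * ballSize σ (x : E d) θ) ^ (1 / q') /
          ENNReal.ofReal (ballSize κ (x : E d) θ) := by gcongr
    _ = ENNReal.ofReal (C ^ (1 / q')) *
          (I / ENNReal.ofReal (ballSize τ (x : E d) θ)) ^ (1 / q) := by
        rw [ENNReal.div_rpow_of_nonneg _ _ (by positivity),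
          ENNReal.ofReal_rpow_of_pos (by positivity), ENNReal.ofReal_rpow_of_pos hs2,
          mul_div_assoc, ← ENNReal.ofReal_div_of_pos hs3, div_eq_mul_inv (I ^ (1 / q)),
          ← ENNReal.ofReal_inv_of_pos (by positivity), mul_left_comm _ (I ^ (1 / q)),
          ← ENNReal.ofReal_mul (by positivity), ← hsize, Real.mul_rpow hC0.le hs1.le]
        congr 2
        field_simp
    _ ≤ _ := by
        gcongr
        rfl

/-- Truncated weak type estimate for the ball maximal function. -/
theorem exists_truncated_weakType_ballMaximal {τ : Fin (d + 1) → ℝ}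
    (hτ : ∀ j, -(1 / 2 : ℝ) < τ j) :
    ∃ C B : ℝ≥0, ∀ g : S d → ℝ≥0∞, Measurable g → ∀ l : ℝ≥0∞,
      l * weightedMeasure τ {x | l < ballMaximal τ g x} ≤
        C * ∫⁻ y in {y | l < B * g y}, g y ∂(weightedMeasure τ) := by
  obtain ⟨C, hC⟩ := exists_weakType_ballMaximal hτ
  obtain ⟨A, hA0, hA⟩ := exists_weightedMeasure_absBall_le hτ
  refine ⟨2 * C, (2 * A).toNNReal, fun g hg l => ?_⟩
  set B : ℝ≥0∞ := ((2 * A).toNNReal : ℝ≥0∞) with hB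
  have hB' : B = 2 * ENNReal.ofReal A := by
    rw [hB]
    change ENNReal.ofReal (2 * A) = _
    rw [ENNReal.ofReal_mul zero_le_two, ENNReal.ofReal_ofNat]
  set D := {y | l < B * g y} with hD
  have hDm : MeasurableSet D := measurableSet_lt measurable_const (hg.const_mul _)
  -- Off D, g ≤ l/B. A ball has mass at most A times its size, so B = 2A makes this part contribute
  -- at most l/2.
  have hmax : ∀ x, ballMaximal τ g x ≤ ballMaximal τ (D.indicator g) x + l / 2 := by
    intro x
    refine iSup₂_le fun θ hθ => ?_
    have hs := ballSize_pos τ (x : E d) hθ.1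
    have hs0 : ENNReal.ofReal (ballSize τ (x : E d) θ) ≠ 0 := by simpa using hs
    have hA1 : ENNReal.ofReal A ≠ 0 := by simpa using hA0
    have hg2 : ∀ y, g y ≤ D.indicator g y + l / B := by
      intro y
      by_cases hy : y ∈ D
      · rw [Set.indicator_of_mem hy]
        exact le_self_add
      · rw [Set.indicator_of_notMem hy, zero_add, ENNReal.le_div_iff_mul_le
          (Or.inl (by simpa using hA0)) (Or.inl ENNReal.coe_ne_top), mul_comm]
        exact not_lt.1 hy
    have hmeas : weightedMeasure τ (absBall (x : E d) θ) ≤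
        ENNReal.ofReal A * ENNReal.ofReal (ballSize τ (x : E d) θ) := by
      rw [← ENNReal.ofReal_mul hA0.le]
      refine (measure_mono (absBall_mono _ ?_)).trans (hA x θ hθ.1 hθ.2)
      linarith [hθ.1]
    calc _ ≤ ((∫⁻ y in absBall (x : E d) θ, D.indicator g y ∂(weightedMeasure τ)) +
          l / B * (ENNReal.ofReal A * ENNReal.ofReal (ballSize τ (x : E d) θ))) /
            ENNReal.ofReal (ballSize τ (x : E d) θ) := by
          gcongr
          calc _ ≤ ∫⁻ y in absBall (x : E d) θ, (D.indicator g y + l / B)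
                ∂(weightedMeasure τ) := lintegral_mono hg2
            _ = _ := lintegral_add_right _ measurable_const
            _ ≤ _ := by
                rw [setLIntegral_const]
                gcongr
      _ = (∫⁻ y in absBall (x : E d) θ, D.indicator g y ∂(weightedMeasure τ)) /
            ENNReal.ofReal (ballSize τ (x : E d) θ) + l / 2 := by
          rw [ENNReal.add_div, ← mul_assoc, ENNReal.mul_div_cancel_right hs0 ENNReal.ofReal_ne_top,
            hB', ENNReal.mul_div_right_comm.symm, ENNReal.mul_div_mul_right _ _ hA1
              ENNReal.ofReal_ne_top]
      _ ≤ _ := by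
          gcongr
          exact le_ballMaximal τ (D.indicator g) x hθ
  have hsub : {x | l < ballMaximal τ g x} ⊆ {x | l / 2 < ballMaximal τ (D.indicator g) x} := by
    intro x hx
    rw [Set.mem_ofPred_eq] at hx ⊢
    by_contra hcon
    push Not at hcon
    have h1 := (hx.trans_le (hmax x)).trans_le (add_le_add_left hcon _)
    rw [ENNReal.add_halves] at h1
    exact lt_irrefl _ h1
  have h2 := hC (D.indicator g) (l / 2)
  rw [lintegral_indicator hDm] at h2
  calc l * weightedMeasure τ {x | l < ballMaximal τ g x}
      ≤ l * weightedMeasure τ {x | l / 2 < ballMaximal τ (D.indicator g) x} := by gcongr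
    _ = 2 * (l / 2 * weightedMeasure τ {x | l / 2 < ballMaximal τ (D.indicator g) x}) := by
        rw [← mul_assoc, ENNReal.mul_div_cancel two_ne_zero ENNReal.ofNat_ne_top]
    _ ≤ 2 * (C * ∫⁻ y in D, g y ∂(weightedMeasure τ)) := by gcongr
    _ = _ := by rw [← mul_assoc]; push_cast; rfl

end BallMaximal

/-! ### From truncated weak type to strong type. -/

section LayerCake

theorem lintegral_indicator_rpow_sub_one {e : ℝ} (he : 0 < e) (a : ℝ≥0∞) :
    ∫⁻ t in Set.Ioi (0 : ℝ), {t : ℝ | ENNReal.ofReal t < a}.indicator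
      (fun t => ENNReal.ofReal (t ^ (e - 1))) t = a ^ e / ENNReal.ofReal e := by
  have hfin : ∀ r : ℝ, 0 ≤ r → ∫⁻ t in Set.Ioo (0 : ℝ) r, ENNReal.ofReal (t ^ (e - 1)) =
      ENNReal.ofReal r ^ e / ENNReal.ofReal e := by
    intro r hr
    rw [Measure.restrict_congr_set Ioo_ae_eq_Ioc, lintegral_rpow_Ioc (by linarith) hr,
      sub_add_cancel, ENNReal.ofReal_div_of_pos he, ENNReal.ofReal_rpow_of_nonneg hr he.le]
  have hm : MeasurableSet {t : ℝ | ENNReal.ofReal t < a} :=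
    measurableSet_lt (by fun_prop) (by fun_prop)
  rw [lintegral_indicator hm, Measure.restrict_restrict hm]
  rcases eq_or_ne a ∞ with rfl | ha
  · rw [ENNReal.top_rpow_of_pos he, ENNReal.top_div_of_ne_top ENNReal.ofReal_ne_top]
    refine ENNReal.eq_top_of_forall_nnreal_le fun r => ?_
    set R : ℝ := ((r : ℝ) * e) ^ (1 / e) with hR
    have hR0 : 0 ≤ R := by positivity
    have h1 : ENNReal.ofReal R ^ e / ENNReal.ofReal e = r := by
      rw [ENNReal.ofReal_rpow_of_nonneg hR0 he.le, hR, ← Real.rpow_mul (by positivity), one_div,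
        inv_mul_cancel₀ he.ne', Real.rpow_one, ← ENNReal.ofReal_div_of_pos he,
        mul_div_cancel_right₀ _ he.ne', ENNReal.ofReal_coe_nnreal]
    rw [← h1, ← hfin R hR0]
    exact lintegral_mono_set fun t ht => ⟨ENNReal.ofReal_lt_top, ht.1⟩
  · have hset : {t : ℝ | ENNReal.ofReal t < a} ∩ Set.Ioi 0 = Set.Ioo 0 a.toReal := by
      ext t
      simp only [Set.mem_inter_iff, Set.mem_ofPred_eq, Set.mem_Ioi, Set.mem_Ioo]
      constructor
      · rintro ⟨h1, h2⟩
        exact ⟨h2, (ENNReal.ofReal_lt_iff_lt_toReal h2.le ha).1 h1⟩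
      · rintro ⟨h1, h2⟩
        exact ⟨(ENNReal.ofReal_lt_iff_lt_toReal h1.le ha).2 h2, h1⟩
    rw [hset, hfin _ ENNReal.toReal_nonneg, ENNReal.ofReal_toReal ha]

/-- A truncated weak type estimate implies a strong type estimate. -/
theorem lintegral_rpow_le_of_truncated_weakType {X : Type*} [MeasurableSpace X] {μ : Measure X}
    [SFinite μ] {F g : X → ℝ≥0∞} (hF : Measurable F) (hg : Measurable g) {s : ℝ} (hs : 1 < s)
    {C B : ℝ≥0} (h : ∀ l : ℝ≥0∞, l * μ {x | l < F x} ≤ C * ∫⁻ x in {x | l < B * g x}, g x ∂μ) :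
    ∫⁻ x, F x ^ s ∂μ ≤
      (ENNReal.ofReal s * C * (B ^ (s - 1) / ENNReal.ofReal (s - 1))) * ∫⁻ x, g x ^ s ∂μ := by
  have hs0 : 0 < s := by linarith
  have hs1 : 0 < s - 1 := by linarith
  have hsne : ENNReal.ofReal s ≠ 0 := by simpa using hs0
  have hFjoint : Measurable (Function.uncurry fun (x : X) (t : ℝ) =>
      {t : ℝ | ENNReal.ofReal t < F x}.indicator (fun t => ENNReal.ofReal (t ^ (s - 1))) t) := by
    have hm : MeasurableSet {p : X × ℝ | ENNReal.ofReal p.2 < F p.1} :=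
      measurableSet_lt (by fun_prop) (by fun_prop)
    exact Measurable.indicator (f := fun p : X × ℝ => ENNReal.ofReal (p.2 ^ (s - 1)))
      (by fun_prop) hm
  have hgjoint : Measurable (Function.uncurry fun (x : X) (t : ℝ) =>
      g x * {t : ℝ | ENNReal.ofReal t < B * g x}.indicator
        (fun t => ENNReal.ofReal (t ^ (s - 1 - 1))) t) := by
    have hm : MeasurableSet {p : X × ℝ | ENNReal.ofReal p.2 < B * g p.1} :=
      measurableSet_lt (by fun_prop) (by fun_prop)
    exact (hg.comp measurable_fst).mul (Measurable.indicator
      (f := fun p : X × ℝ => ENNReal.ofReal (p.2 ^ (s - 1 - 1))) (by fun_prop) hm)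
  have hslice : ∀ t ∈ Set.Ioi (0 : ℝ),
      ∫⁻ x, {t : ℝ | ENNReal.ofReal t < F x}.indicator
        (fun t => ENNReal.ofReal (t ^ (s - 1))) t ∂μ ≤
      C * ∫⁻ x, g x * {t : ℝ | ENNReal.ofReal t < B * g x}.indicator
        (fun t => ENNReal.ofReal (t ^ (s - 1 - 1))) t ∂μ := by
    intro t ht
    have hmF : MeasurableSet {x | ENNReal.ofReal t < F x} := measurableSet_lt (by fun_prop) hF
    have hmg : MeasurableSet {x | ENNReal.ofReal t < B * g x} :=
      measurableSet_lt (by fun_prop) (by fun_prop)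
    have h1 : ∫⁻ x, {t : ℝ | ENNReal.ofReal t < F x}.indicator
        (fun t => ENNReal.ofReal (t ^ (s - 1))) t ∂μ =
        ENNReal.ofReal (t ^ (s - 1)) * μ {x | ENNReal.ofReal t < F x} := by
      rw [← lintegral_indicator_const hmF]
      rfl
    have h2 : ∫⁻ x, g x * {t : ℝ | ENNReal.ofReal t < B * g x}.indicator
        (fun t => ENNReal.ofReal (t ^ (s - 1 - 1))) t ∂μ =
        ENNReal.ofReal (t ^ (s - 1 - 1)) * ∫⁻ x in {x | ENNReal.ofReal t < B * g x}, g x ∂μ := by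
      rw [← lintegral_const_mul' _ _ ENNReal.ofReal_ne_top, ← lintegral_indicator hmg]
      refine lintegral_congr fun x => ?_
      by_cases hx : ENNReal.ofReal t < B * g x
      · rw [Set.indicator_of_mem (show t ∈ {t : ℝ | ENNReal.ofReal t < B * g x} from hx),
          Set.indicator_of_mem (show x ∈ {x | ENNReal.ofReal t < B * g x} from hx), mul_comm]
      · rw [Set.indicator_of_notMem (show t ∉ {t : ℝ | ENNReal.ofReal t < B * g x} from hx),
          Set.indicator_of_notMem (show x ∉ {x | ENNReal.ofReal t < B * g x} from hx), mul_zero]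
    -- One factor t is spent on the weak type estimate; the remaining t^{s-2} is integrable at 0
    -- because s > 1, and its integral up to B g is (B g)^{s-1}/(s-1).
    have h3 : ENNReal.ofReal (t ^ (s - 1)) = ENNReal.ofReal (t ^ (s - 1 - 1)) * ENNReal.ofReal t := by
      rw [← ENNReal.ofReal_mul (Real.rpow_nonneg (le_of_lt ht) _),
        ← Real.rpow_add_one (ne_of_gt ht), sub_add_cancel]
    rw [h1, h2, h3, mul_assoc, mul_left_comm (C : ℝ≥0∞)]
    exact mul_le_mul_right (h _) _
  calc ∫⁻ x, F x ^ s ∂μ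
      = ∫⁻ x, ENNReal.ofReal s * ∫⁻ t in Set.Ioi (0 : ℝ), {t : ℝ | ENNReal.ofReal t < F x}.indicator
          (fun t => ENNReal.ofReal (t ^ (s - 1))) t ∂volume ∂μ := by
        refine lintegral_congr fun x => ?_
        rw [lintegral_indicator_rpow_sub_one hs0, ENNReal.mul_div_cancel hsne ENNReal.ofReal_ne_top]
    _ = ENNReal.ofReal s * ∫⁻ t in Set.Ioi (0 : ℝ), (∫⁻ x,
          {t : ℝ | ENNReal.ofReal t < F x}.indicator
            (fun t => ENNReal.ofReal (t ^ (s - 1))) t ∂μ) := by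
        rw [lintegral_const_mul' _ _ ENNReal.ofReal_ne_top,
          lintegral_lintegral_swap hFjoint.aemeasurable]
    _ ≤ ENNReal.ofReal s * ∫⁻ t in Set.Ioi (0 : ℝ), (C * ∫⁻ x,
          g x * {t : ℝ | ENNReal.ofReal t < B * g x}.indicator
            (fun t => ENNReal.ofReal (t ^ (s - 1 - 1))) t ∂μ) :=
        mul_le_mul_right (setLIntegral_mono' measurableSet_Ioi hslice) _
    _ = ENNReal.ofReal s * (C * ∫⁻ x, g x * ((B * g x) ^ (s - 1) / ENNReal.ofReal (s - 1)) ∂μ) := by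
        rw [lintegral_const_mul' _ _ ENNReal.coe_ne_top,
          ← lintegral_lintegral_swap hgjoint.aemeasurable]
        congr 2
        refine lintegral_congr fun x => ?_
        rw [lintegral_const_mul, lintegral_indicator_rpow_sub_one hs1]
        exact Measurable.indicator (by fun_prop) (measurableSet_lt (by fun_prop) (by fun_prop))
    _ = _ := by
        rw [mul_assoc (ENNReal.ofReal s * C), mul_assoc,
          ← lintegral_const_mul (B ^ (s - 1) / ENNReal.ofReal (s - 1) : ℝ≥0∞) (hg.pow_const s)]
        congr 2
        refine lintegral_congr fun x => ?_
        have h5 : g x ^ s = g x * g x ^ (s - 1) := by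
          conv_rhs => rw [← ENNReal.rpow_one (g x), ← ENNReal.rpow_mul, one_mul]
          rw [← ENNReal.rpow_add_of_nonneg _ _ zero_le_one hs1.le, add_sub_cancel]
        rw [h5, ENNReal.mul_rpow_of_nonneg _ _ hs1.le]
        simp only [div_eq_mul_inv]
        ring

end LayerCake

/-! ### Measurability and elementary properties of the maximal function. -/

section Measurability

variable {d : ℕ}

theorem measurable_kernel {κ : Fin (d + 1) → ℝ} (hκ : ∀ j, 0 ≤ κ j) (θ : ℝ) :
    Measurable fun p : E d × E d => kernel κ p.1 θ p.2 := by
  have := isProbabilityMeasure_cubeMeasure hκ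
  have hset : MeasurableSet {p : (E d × E d) × (Fin (d + 1) → ℝ) |
      ‖hadamard p.1.2 p.2‖ ≤ 1 ∧ Real.cos θ ≤ inner ℝ p.1.1 (hadamard p.1.2 p.2)} := by
    have hh : Measurable fun p : (E d × E d) × (Fin (d + 1) → ℝ) => hadamard p.1.2 p.2 :=
      measurable_hadamard.comp ((measurable_snd.comp measurable_fst).prodMk measurable_snd)
    have h1 : MeasurableSet {p : (E d × E d) × (Fin (d + 1) → ℝ) | ‖hadamard p.1.2 p.2‖ ≤ 1} :=
      measurableSet_le hh.norm measurable_const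
    have h2 : MeasurableSet {p : (E d × E d) × (Fin (d + 1) → ℝ) |
        Real.cos θ ≤ inner ℝ p.1.1 (hadamard p.1.2 p.2)} :=
      measurableSet_le measurable_const ((measurable_fst.comp measurable_fst).inner hh)
    exact h1.inter h2
  have hf : StronglyMeasurable (Function.uncurry fun (p : E d × E d) (t : Fin (d + 1) → ℝ) =>
      (solidCap p.1 θ).indicator (fun _ => (1 : ℝ)) (hadamard p.2 t)) := by
    exact stronglyMeasurable_const.indicator hset
  exact hf.integral_prod_right.measurable

theorem kernel_mono {κ : Fin (d + 1) → ℝ} (hκ : ∀ j, 0 ≤ κ j) (x y : E d) {θ θ' : ℝ}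
    (h0 : 0 ≤ θ) (h : θ ≤ θ') (hπ : θ' ≤ Real.pi) : kernel κ x θ y ≤ kernel κ x θ' y := by
  have := isProbabilityMeasure_cubeMeasure hκ
  rw [kernel_eq_measureReal, kernel_eq_measureReal]
  refine measureReal_mono fun t ht => ⟨ht.1, ?_⟩
  exact (Real.cos_le_cos_of_nonneg_of_le_pi h0 hπ h).trans ht.2

/-- Caps are closed and grow with θ, so for each fixed point the indicator is constant immediately
to the right of θ; dominated convergence does the rest. -/
theorem tendsto_kernel_right {κ : Fin (d + 1) → ℝ} (hκ : ∀ j, 0 ≤ κ j) (x y : E d) {θ : ℝ}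
    (h0 : 0 ≤ θ) (hπ : θ < Real.pi) :
    Filter.Tendsto (fun θ' => kernel κ x θ' y) (nhdsWithin θ (Set.Ioi θ))
      (nhds (kernel κ x θ y)) := by
  have := isProbabilityMeasure_cubeMeasure hκ
  have hm : Measurable (hadamard y) := by unfold hadamard; fun_prop
  have hlt : ∀ᶠ θ' in nhdsWithin θ (Set.Ioi θ), θ' ∈ Set.Ioo θ Real.pi :=
    Ioo_mem_nhdsGT hπ
  unfold kernel V
  refine tendsto_integral_filter_of_dominated_convergence (fun _ => 1) ?_ ?_
    (integrable_const _) ?_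
  · refine Filter.Eventually.of_forall fun θ' => Measurable.aestronglyMeasurable ?_
    exact (measurable_const.indicator (measurableSet_solidCap x θ')).comp hm
  · refine Filter.Eventually.of_forall fun θ' => ae_of_all _ fun t => ?_
    exact (norm_indicator_le_norm_self _ _).trans (by simp)
  · refine ae_of_all _ fun t => ?_
    refine tendsto_const_nhds.congr' ?_
    set z := hadamard y t with hz
    change ∀ᶠ θ' in nhdsWithin θ (Set.Ioi θ), (solidCap x θ).indicator (fun _ => (1 : ℝ)) z =
      (solidCap x θ').indicator (fun _ => (1 : ℝ)) z
    by_cases h1 : z ∈ solidCap x θ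
    · filter_upwards [hlt] with θ' hθ'
      have h2 : z ∈ solidCap x θ' :=
        ⟨h1.1, (Real.cos_le_cos_of_nonneg_of_le_pi h0 hθ'.2.le hθ'.1.le).trans h1.2⟩
      rw [Set.indicator_of_mem h1, Set.indicator_of_mem h2]
    · by_cases hn : ‖z‖ ≤ 1
      · have h3 : inner ℝ x z < Real.cos θ := by
          by_contra hcon
          exact h1 ⟨hn, not_lt.1 hcon⟩
        have h4 : ∀ᶠ θ' in nhdsWithin θ (Set.Ioi θ), inner ℝ x z < Real.cos θ' :=
          (Real.continuous_cos.continuousAt.eventually (lt_mem_nhds h3)).filter_mono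
            nhdsWithin_le_nhds
        filter_upwards [h4] with θ' hθ'
        rw [Set.indicator_of_notMem h1, Set.indicator_of_notMem fun h => absurd h.2 (not_le.2 hθ')]
      · refine Filter.Eventually.of_forall fun θ' => ?_
        rw [Set.indicator_of_notMem h1, Set.indicator_of_notMem fun h => hn h.1]

theorem kernel_le_one {κ : Fin (d + 1) → ℝ} (hκ : ∀ j, 0 ≤ κ j) (x y : E d) (θ : ℝ) :
    kernel κ x θ y ≤ 1 := by
  have := isProbabilityMeasure_cubeMeasure hκ
  rw [kernel_eq_measureReal]
  exact measureReal_le_one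

theorem measurable_coe_kernel {κ : Fin (d + 1) → ℝ} (hκ : ∀ j, 0 ≤ κ j) (θ : ℝ) :
    Measurable fun p : S d × S d => ENNReal.ofReal (kernel κ (p.1 : E d) θ (p.2 : E d)) :=
  ((measurable_kernel hκ θ).comp (g := fun p : E d × E d => kernel κ p.1 θ p.2)
    (f := fun p : S d × S d => ((p.1 : E d), (p.2 : E d))) (by fun_prop)).ennreal_ofReal

theorem measurable_coe_kernel_right {κ : Fin (d + 1) → ℝ} (hκ : ∀ j, 0 ≤ κ j) (x : S d) (θ : ℝ) :
    Measurable fun y : S d => ENNReal.ofReal (kernel κ (x : E d) θ (y : E d)) := by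
  have h : Measurable fun y : S d => ((x : E d), (y : E d)) := by fun_prop
  exact ((measurable_kernel hκ θ).comp h).ennreal_ofReal

theorem lintegral_kernel_ne_top {κ : Fin (d + 1) → ℝ} (hκ : ∀ j, 0 ≤ κ j) (x : S d) (θ : ℝ) :
    ∫⁻ y, ENNReal.ofReal (kernel κ (x : E d) θ (y : E d)) ∂(weightedMeasure κ) ≠ ∞ := by
  have := isFiniteMeasure_weightedMeasure fun j => (by linarith [hκ j] : -(1 / 2 : ℝ) < κ j)
  refine ne_top_of_le_ne_top (measure_ne_top (weightedMeasure κ) Set.univ) ?_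
  rw [← lintegral_one]
  exact lintegral_mono fun y => ENNReal.ofReal_le_one.2 (kernel_le_one hκ _ _ _)

theorem tendsto_lintegral_kernel_right {κ : Fin (d + 1) → ℝ} (hκ : ∀ j, 0 ≤ κ j) (x : S d)
    {θ : ℝ} (h0 : 0 ≤ θ) (hπ : θ < Real.pi) :
    Filter.Tendsto
      (fun θ' => ∫⁻ y, ENNReal.ofReal (kernel κ (x : E d) θ' (y : E d)) ∂(weightedMeasure κ))
      (nhdsWithin θ (Set.Ioi θ))
      (nhds (∫⁻ y, ENNReal.ofReal (kernel κ (x : E d) θ (y : E d)) ∂(weightedMeasure κ))) := by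
  have := isFiniteMeasure_weightedMeasure fun j => (by linarith [hκ j] : -(1 / 2 : ℝ) < κ j)
  refine tendsto_lintegral_filter_of_dominated_convergence (fun _ => 1) ?_ ?_ ?_ ?_
  · exact Filter.Eventually.of_forall (measurable_coe_kernel_right hκ x)
  · refine Filter.Eventually.of_forall fun θ' => ae_of_all _ fun y => ?_
    exact ENNReal.ofReal_le_one.2 (kernel_le_one hκ _ _ _)
  · simp
  · exact ae_of_all _ fun y => ENNReal.tendsto_ofReal (tendsto_kernel_right hκ _ _ h0 hπ)

/-- The quotient whose supremum over `θ` is the maximal function. -/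
def average (κ : Fin (d + 1) → ℝ) (f : S d → ℝ) (x : S d) (θ : ℝ) : ℝ≥0∞ :=
  (∫⁻ y, ‖f y‖ₑ * ENNReal.ofReal (kernel κ (x : E d) θ (y : E d)) ∂(weightedMeasure κ)) /
    (∫⁻ y, ENNReal.ofReal (kernel κ (x : E d) θ (y : E d)) ∂(weightedMeasure κ))

theorem measurable_average {κ : Fin (d + 1) → ℝ} (hκ : ∀ j, 0 ≤ κ j) {f : S d → ℝ}
    (hf : Measurable f) (θ : ℝ) : Measurable fun x => average κ f x θ := by
  have := isFiniteMeasure_weightedMeasure fun j => (by linarith [hκ j] : -(1 / 2 : ℝ) < κ j)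
  have hk := measurable_coe_kernel hκ θ
  refine Measurable.div ?_ ?_
  · exact Measurable.lintegral_prod_right'
      (f := fun p : S d × S d => ‖f p.2‖ₑ * ENNReal.ofReal (kernel κ (p.1 : E d) θ (p.2 : E d)))
      ((hf.comp measurable_snd).enorm.mul hk)
  · exact Measurable.lintegral_prod_right'
      (f := fun p : S d × S d => ENNReal.ofReal (kernel κ (p.1 : E d) θ (p.2 : E d))) hk

/-- Moving θ up to a nearby rational does not decrease the numerator and hardly changes the
denominator, so no integrability of f is needed. The endpoint π has no room on its right and is
added by hand. -/
theorem maximal_eq_iSup_countable {κ : Fin (d + 1) → ℝ} (hκ : ∀ j, 0 ≤ κ j) (f : S d → ℝ)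
    (x : S d) :
    maximal κ f x = ⨆ θ ∈ (insert Real.pi (Set.range ((↑) : ℚ → ℝ)) ∩ Set.Ioc (0 : ℝ) Real.pi),
      average κ f x θ := by
  refine le_antisymm (iSup₂_le fun θ hθ => ?_) (biSup_mono fun θ hθ => hθ.2)
  rcases hθ.2.eq_or_lt with rfl | hlt
  · exact le_iSup₂ (f := fun (θ : ℝ) (_ : θ ∈ insert Real.pi (Set.range ((↑) : ℚ → ℝ)) ∩
      Set.Ioc (0 : ℝ) Real.pi) => average κ f x θ) Real.pi ⟨Set.mem_insert _ _, hθ⟩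
  · refine le_of_forall_lt fun a ha => ?_
    set N := ∫⁻ y, ‖f y‖ₑ * ENNReal.ofReal (kernel κ (x : E d) θ (y : E d)) ∂(weightedMeasure κ)
      with hN
    have hT : Filter.Tendsto (fun θ' => N /
        ∫⁻ y, ENNReal.ofReal (kernel κ (x : E d) θ' (y : E d)) ∂(weightedMeasure κ))
        (nhdsWithin θ (Set.Ioi θ)) (nhds (N /
          ∫⁻ y, ENNReal.ofReal (kernel κ (x : E d) θ (y : E d)) ∂(weightedMeasure κ))) :=
      ENNReal.Tendsto.const_div (tendsto_lintegral_kernel_right hκ x hθ.1.le hlt)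
        (Or.inl (lintegral_kernel_ne_top hκ x θ))
    have hev := (hT.eventually (lt_mem_nhds ha)).and (Ioo_mem_nhdsGT hlt)
    obtain ⟨u, hu, hsub⟩ := (mem_nhdsGT_iff_exists_Ioo_subset).1 hev
    obtain ⟨q, hq1, hq2⟩ := exists_rat_btwn (show θ < u from hu)
    obtain ⟨h1, h2⟩ := hsub ⟨hq1, hq2⟩
    have hmem : (q : ℝ) ∈ insert Real.pi (Set.range ((↑) : ℚ → ℝ)) ∩ Set.Ioc (0 : ℝ) Real.pi :=
      ⟨Or.inr ⟨q, rfl⟩, hθ.1.trans h2.1, h2.2.le⟩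
    refine lt_of_lt_of_le (h1.trans_le ?_)
      (le_iSup₂ (f := fun (θ : ℝ) (_ : θ ∈ insert Real.pi (Set.range ((↑) : ℚ → ℝ)) ∩
        Set.Ioc (0 : ℝ) Real.pi) => average κ f x θ) (q : ℝ) hmem)
    refine ENNReal.div_le_div_right (lintegral_mono fun y => ?_) _
    gcongr
    exact kernel_mono hκ _ _ hθ.1.le h2.1.le h2.2.le

theorem measurable_maximal {κ : Fin (d + 1) → ℝ} (hκ : ∀ j, 0 ≤ κ j) {f : S d → ℝ}
    (hf : Measurable f) : Measurable (maximal κ f) := by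
  have h : maximal κ f = fun x => ⨆ θ ∈ (insert Real.pi (Set.range ((↑) : ℚ → ℝ)) ∩
      Set.Ioc (0 : ℝ) Real.pi), average κ f x θ := funext (maximal_eq_iSup_countable hκ f)
  rw [h]
  exact Measurable.biSup _ (((Set.countable_range _).insert _).mono Set.inter_subset_left)
    fun θ _ => measurable_average hκ hf θ

/-- The equality holds at every point, since f enters only through integrals; this allows replacing
f by a Borel representative. -/
theorem maximal_congr {κ : Fin (d + 1) → ℝ} {f g : S d → ℝ} (h : f =ᵐ[surface d] g) :
    maximal κ f = maximal κ g := by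
  funext x
  unfold maximal
  refine iSup_congr fun θ => iSup_congr fun _ => ?_
  congr 1
  refine lintegral_congr_ae ?_
  filter_upwards [(weightedMeasure_absolutelyContinuous κ).ae_le h] with y hy
  rw [hy]

theorem maximal_le_of_ae_le {κ : Fin (d + 1) → ℝ} {f : S d → ℝ} {a : ℝ≥0∞}
    (h : ∀ᵐ y ∂(surface d), ‖f y‖ₑ ≤ a) (x : S d) (hκ : ∀ j, 0 ≤ κ j) : maximal κ f x ≤ a := by
  refine iSup₂_le fun θ _ => ENNReal.div_le_of_le_mul ?_
  rw [← lintegral_const_mul _ (measurable_coe_kernel_right hκ x θ)]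
  refine lintegral_mono_ae ?_
  filter_upwards [(weightedMeasure_absolutelyContinuous κ).ae_le h] with y hy
  gcongr

end Measurability

/-! ### Weak and strong type of the maximal function. -/

section Main

variable {d : ℕ}

theorem weakType_maximal {κ τ : Fin (d + 1) → ℝ} (hκ : ∀ j, 0 ≤ κ j)
    (hτ : ∀ j, -(1 / 2 : ℝ) < τ j) (hτκ : ∀ j, τ j ≤ κ j) :
    ∃ c : ℝ≥0, ∀ (f : S d → ℝ) (α : ℝ), 0 < α →
      weightedMeasure τ {x | ENNReal.ofReal α ≤ maximal κ f x} ≤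
        c * eLpNorm f 1 (weightedMeasure τ) / ENNReal.ofReal α := by
  obtain ⟨A, hA⟩ := exists_maximal_le_ballMaximal hκ
  obtain ⟨C, hC⟩ := exists_weakType_ballMaximal hτ
  refine ⟨C * (2 * (A + 1)), fun f α hα => ?_⟩
  have hα0 : ENNReal.ofReal α ≠ 0 := by simpa using hα
  have hA0 : (2 * ((A + 1 : ℝ≥0) : ℝ≥0∞)) ≠ 0 := by simp
  have hA1 : (2 * ((A + 1 : ℝ≥0) : ℝ≥0∞)) ≠ ∞ :=
    ENNReal.mul_ne_top ENNReal.ofNat_ne_top ENNReal.coe_ne_top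
  -- The 2 turns the closed level condition into a strict one; A + 1 keeps the divisor nonzero.
  set l : ℝ≥0∞ := ENNReal.ofReal α / (2 * ((A + 1 : ℝ≥0) : ℝ≥0∞)) with hl
  have hlA : l * (2 * ((A + 1 : ℝ≥0) : ℝ≥0∞)) = ENNReal.ofReal α :=
    ENNReal.div_mul_cancel hA0 hA1
  have hsub : {x | ENNReal.ofReal α ≤ maximal κ f x} ⊆
      {x | l < ballMaximal τ (fun y => ‖f y‖ₑ) x} := by
    intro x hx
    rw [Set.mem_ofPred_eq] at hx ⊢
    by_contra hcon
    push Not at hcon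
    have hle : ENNReal.ofReal α ≤ ENNReal.ofReal α / 2 := by
      calc ENNReal.ofReal α ≤ A * ballMaximal κ (fun y => ‖f y‖ₑ) x := hx.trans (hA f x)
        _ ≤ ((A + 1 : ℝ≥0) : ℝ≥0∞) * l := by
            gcongr
            · simp
            · exact (ballMaximal_le_of_le hτκ _ x).trans hcon
        _ = ENNReal.ofReal α / 2 := by
            rw [← hlA, ENNReal.eq_div_iff two_ne_zero ENNReal.ofNat_ne_top]
            ring
    exact absurd hle (not_le.2 (ENNReal.half_lt_self hα0 ENNReal.ofReal_ne_top))
  rw [ENNReal.le_div_iff_mul_le (Or.inl hα0) (Or.inl ENNReal.ofReal_ne_top),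
    eLpNorm_one_eq_lintegral_enorm, ← hlA]
  calc _ ≤ weightedMeasure τ {x | l < ballMaximal τ (fun y => ‖f y‖ₑ) x} *
        (l * (2 * ((A + 1 : ℝ≥0) : ℝ≥0∞))) := by
        rw [hlA]
        exact mul_le_mul_left (measure_mono hsub) _
    _ = (l * weightedMeasure τ {x | l < ballMaximal τ (fun y => ‖f y‖ₑ) x}) *
        (2 * ((A + 1 : ℝ≥0) : ℝ≥0∞)) := by ring
    _ ≤ (C * ∫⁻ y, ‖f y‖ₑ ∂(weightedMeasure τ)) * (2 * ((A + 1 : ℝ≥0) : ℝ≥0∞)) :=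
        mul_le_mul_left (hC _ _) _
    _ = _ := by push_cast; ring

/-- The finitely many strict conditions are open in the exponent; the gap between q and p is what
makes p/q > 1 available. -/
theorem exists_exponent_lt {κ τ : Fin (d + 1) → ℝ} {p : ℝ} (hp : 1 < p)
    (h : ∀ j, τ j < p * κ j + (p - 1) / 2) :
    ∃ q, 1 < q ∧ q < p ∧ ∀ j, τ j < q * κ j + (q - 1) / 2 := by
  have h1 : ∀ᶠ q in nhdsWithin p (Set.Iio p), ∀ j, τ j < q * κ j + (q - 1) / 2 := by
    rw [Filter.eventually_all]
    intro j
    have hc : Continuous fun q : ℝ => q * κ j + (q - 1) / 2 := by fun_prop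
    exact (hc.continuousAt.eventually (lt_mem_nhds (h j))).filter_mono nhdsWithin_le_nhds
  obtain ⟨q, hq, hq1, hq2⟩ := (h1.and (Ioo_mem_nhdsLT hp)).exists
  exact ⟨q, hq1, hq2, hq⟩

theorem exists_lintegral_maximal_rpow_le {κ τ : Fin (d + 1) → ℝ} (hκ : ∀ j, 0 ≤ κ j)
    (hτ : ∀ j, -(1 / 2 : ℝ) < τ j) {p : ℝ} (hp : 1 < p)
    (hτκ : ∀ j, τ j < p * κ j + (p - 1) / 2) :
    ∃ c : ℝ≥0, ∀ f : S d → ℝ, Measurable f →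
      ∫⁻ x, maximal κ f x ^ p ∂(weightedMeasure τ) ≤
        c * ∫⁻ x, ‖f x‖ₑ ^ p ∂(weightedMeasure τ) := by
  obtain ⟨q, hq1, hqp, hq⟩ := exists_exponent_lt hp hτκ
  have hq0 : 0 < q := by linarith
  have hp0 : 0 < p := by linarith
  have hs : 1 < p / q := by rwa [one_lt_div hq0]
  obtain ⟨A, hA⟩ := exists_maximal_le_ballMaximal hκ
  obtain ⟨D, hD⟩ := exists_ballMaximal_le_rpow hq1 hq
  obtain ⟨C, B, hCB⟩ := exists_truncated_weakType_ballMaximal hτ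
  have := isFiniteMeasure_weightedMeasure hτ
  set a : ℝ≥0 := A * D + 1 with ha
  have ha0 : (a : ℝ≥0∞) ≠ 0 := by simp [ha]
  set K : ℝ≥0∞ := ENNReal.ofReal (p / q) * C * (B ^ (p / q - 1) / ENNReal.ofReal (p / q - 1))
    with hK
  have hKtop : K ≠ ∞ := by
    have hs1 : 0 < p / q - 1 := by linarith
    refine ENNReal.mul_ne_top (ENNReal.mul_ne_top ENNReal.ofReal_ne_top ENNReal.coe_ne_top) ?_
    exact ENNReal.div_ne_top (ENNReal.rpow_ne_top_of_nonneg hs1.le ENNReal.coe_ne_top)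
      (by simpa using hs1)
  refine ⟨a ^ p * K.toNNReal, fun f hf => ?_⟩
  set g : S d → ℝ≥0∞ := fun y => ‖f y‖ₑ ^ q with hg
  have hgm : Measurable g := hf.enorm.pow_const q
  -- The layer-cake argument needs a measurable function, so it is run on this minorant of
  -- `ballMaximal τ g`, which inherits the truncated weak type.
  set F : S d → ℝ≥0∞ := fun x => (maximal κ f x / a) ^ q with hF
  have hFm : Measurable F := ((measurable_maximal hκ hf).div_const _).pow_const q
  have hFle : ∀ x, F x ≤ ballMaximal τ g x := by
    intro x
    have h1 : maximal κ f x ≤ a * ballMaximal τ g x ^ (1 / q) := by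
      calc maximal κ f x ≤ A * ballMaximal κ (fun y => ‖f y‖ₑ) x := hA f x
        _ ≤ A * (D * ballMaximal τ g x ^ (1 / q)) := by
            gcongr
            exact hD _ hf.enorm x
        _ = ((A * D : ℝ≥0) : ℝ≥0∞) * ballMaximal τ g x ^ (1 / q) := by push_cast; ring
        _ ≤ _ := by
            gcongr
            simp [ha]
    have h2 : maximal κ f x / a ≤ ballMaximal τ g x ^ (1 / q) := ENNReal.div_le_of_le_mul' h1
    calc F x ≤ (ballMaximal τ g x ^ (1 / q)) ^ q := ENNReal.rpow_le_rpow h2 hq0.le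
      _ = ballMaximal τ g x := by
          rw [← ENNReal.rpow_mul, one_div, inv_mul_cancel₀ hq0.ne', ENNReal.rpow_one]
  have hmain := lintegral_rpow_le_of_truncated_weakType (μ := weightedMeasure τ) hFm hgm hs
    (C := C) (B := B) fun l => le_trans (by gcongr; exact hFle _) (hCB g hgm l)
  have hgp : ∀ x, g x ^ (p / q) = ‖f x‖ₑ ^ p := fun x => by
    simp only [hg]
    rw [← ENNReal.rpow_mul, mul_div_cancel₀ _ hq0.ne']
  have hFp : ∀ x, maximal κ f x ^ p = (a : ℝ≥0∞) ^ p * F x ^ (p / q) := fun x => by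
    simp only [hF]
    rw [← ENNReal.rpow_mul, mul_div_cancel₀ _ hq0.ne', ← ENNReal.mul_rpow_of_nonneg _ _ hp0.le,
      ENNReal.mul_div_cancel ha0 ENNReal.coe_ne_top]
  simp only [hgp] at hmain
  simp only [hFp]
  rw [lintegral_const_mul _ (hFm.pow_const _), ENNReal.coe_mul, ENNReal.coe_toNNReal hKtop,
    ← ENNReal.coe_rpow_of_nonneg _ hp0.le, mul_assoc]
  gcongr

theorem strongType_maximal {κ τ : Fin (d + 1) → ℝ} (hκ : ∀ j, 0 ≤ κ j)
    (hτ : ∀ j, -(1 / 2 : ℝ) < τ j) {p : ℝ≥0∞} (hp : 1 < p)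
    (hτκ : p ≠ ∞ → ∀ j, τ j < p.toReal * κ j + (p.toReal - 1) / 2) :
    ∃ c : ℝ≥0, ∀ f : S d → ℝ, Measurable f →
      eLpNorm (maximal κ f) p (weightedMeasure τ) ≤ c * eLpNorm f p (weightedMeasure τ) := by
  rcases eq_or_ne p ∞ with rfl | hp'
  · refine ⟨1, fun f hf => ?_⟩
    rw [ENNReal.coe_one, one_mul, eLpNorm_exponent_top, eLpNorm_exponent_top]
    refine eLpNormEssSup_le_of_ae_enorm_bound (ae_of_all _ fun x => ?_)
    rw [enorm_eq_self]
    refine maximal_le_of_ae_le ?_ x hκ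
    exact (surface_absolutelyContinuous τ).ae_le (enorm_ae_le_eLpNormEssSup _ _)
  · have hp1 : 1 < p.toReal := by
      rwa [← ENNReal.toReal_one, ENNReal.toReal_lt_toReal ENNReal.one_ne_top hp']
    have hp0 : 0 < p.toReal := by linarith
    obtain ⟨c, hc⟩ := exists_lintegral_maximal_rpow_le hκ hτ hp1 (hτκ hp')
    refine ⟨c ^ (1 / p.toReal), fun f hf => ?_⟩
    have hpne : p ≠ 0 := (zero_lt_one.trans hp).ne'
    rw [eLpNorm_eq_lintegral_rpow_enorm_toReal hpne hp',
      eLpNorm_eq_lintegral_rpow_enorm_toReal hpne hp',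
      ENNReal.coe_rpow_of_nonneg _ (by positivity : 0 ≤ 1 / p.toReal),
      ← ENNReal.mul_rpow_of_nonneg _ _ (by positivity : 0 ≤ 1 / p.toReal)]
    simp only [enorm_eq_self]
    exact ENNReal.rpow_le_rpow (hc f hf) (by positivity)

end Main

end SphereMaximal

end

theorem mainTheorem6 (d : ℕ) (κ τ : Fin (d + 1) → ℝ) (hκ : ∀ j, 0 ≤ κ j)
    (hτ : ∀ j, -(1 / 2 : ℝ) < τ j) :
    -- weak type (1,1)
    ((∀ j, τ j ≤ κ j) →
      ∃ c : ℝ≥0, ∀ f : SphereMaximal.S d → ℝ,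
        MemLp f 1 (SphereMaximal.weightedMeasure τ) →
        ∀ α : ℝ, 0 < α →
          SphereMaximal.weightedMeasure τ
              {x | ENNReal.ofReal α ≤ SphereMaximal.maximal κ f x} ≤
            c * eLpNorm f 1 (SphereMaximal.weightedMeasure τ) / ENNReal.ofReal α) ∧
    -- strong type (p,p), `1 < p ≤ ∞`; for `p = ∞` the upper bound on `τ` is void
    (∀ p : ℝ≥0∞, 1 < p →
      (p ≠ ∞ → ∀ j, τ j < p.toReal * κ j + (p.toReal - 1) / 2) →
      ∃ c : ℝ≥0, ∀ f : SphereMaximal.S d → ℝ,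
        MemLp f p (SphereMaximal.weightedMeasure τ) →
          AEMeasurable (SphereMaximal.maximal κ f) (SphereMaximal.weightedMeasure τ) ∧
          eLpNorm (SphereMaximal.maximal κ f) p (SphereMaximal.weightedMeasure τ) ≤
            c * eLpNorm f p (SphereMaximal.weightedMeasure τ)) ∧
    -- `p = ∞` for continuous functions with the uniform norm
    (∃ c : ℝ≥0, ∀ f : C(SphereMaximal.S d, ℝ),
      (⨆ x, SphereMaximal.maximal κ f x) ≤ c * ‖f‖ₑ) := by
  refine ⟨fun hτκ => ?_, fun p hp hτκ => ?_, 1, fun f => iSup_le fun x => ?_⟩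
  · obtain ⟨c, hc⟩ := SphereMaximal.weakType_maximal hκ hτ hτκ
    exact ⟨c, fun f _ => hc f⟩
  · obtain ⟨c, hc⟩ := SphereMaximal.strongType_maximal hκ hτ hp hτκ
    refine ⟨c, fun f hf => ?_⟩
    -- The Borel representative agrees with f almost everywhere for h_τ² dω, hence for surface
    -- measure, hence has the same maximal function.
    obtain ⟨g, hg, hfg⟩ := hf.aestronglyMeasurable.aemeasurable
    have hsurf := (SphereMaximal.surface_absolutelyContinuous τ).ae_le hfg
    rw [SphereMaximal.maximal_congr (κ := κ) hsurf, eLpNorm_congr_ae hfg]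
    exact ⟨(SphereMaximal.measurable_maximal hκ hg).aemeasurable, hc g hg⟩
  · rw [ENNReal.coe_one, one_mul]
    refine SphereMaximal.maximal_le_of_ae_le (Filter.Eventually.of_forall fun y => ?_) x hκ
    rw [enorm_le_iff_norm_le]
    exact f.norm_coe_le_norm y
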